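/- Let $\mathbf S$ be a category with finite products (terminal object $\star$), and let $\mathscr C$ be an $\mathbf S$-indexed symmetric monoidal category, i.e. a pseudofunctor $A\mapsto\mathscr C^A$, $f\mapsto f^*$, from $\mathbf S^{op}$ to the 2-category of symmetric monoidal categories, strong symmetric monoidal functors and monoidal natural transformations. Write $\otimes_A$, $I_A$ for the tensor product and unit of $\mathscr C^A$. Assume that $\mathscr C$ has indexed homotopy coproducts preserved by $\otimes$, in the following sense. 1. Every reindexing functor $f^*$ has a left adjoint $f_!$. 2. The Beck--Chevalley condition holds: for a square with $f:A\to B$, $h:A\to D$, $g:B\to E$, $k:D\to E$ and $gf=kh$, the canonical map $f_!h^*\to f_!h^*k^*k_!\cong f_!f^*g^*k_!\to g^*k_!$ is an isomorphism whenever the square $(f,h,g,k)$ is, for some objects and morphisms of $\mathbf S$, one of $(f\times\mathrm{id}_D,\ \mathrm{id}_A\times g,\ \mathrm{id}_B\times g,\ f\times\mathrm{id}_E)$ for $f:A\to B$, $g:D\to E$ (commutativity with reindexing); $(\Delta_A,\ \Delta_A,\ \mathrm{id}_A\times\Delta_A,\ \Delta_A\times\mathrm{id}_A)$ (Frobenius);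 $((\mathrm{id}_A,f),\ f,\ f\times\mathrm{id}_B,\ \Delta_B)$ for $f:A\to B$ (sliding and splitting); or is obtained from these by transposition, products with a fixed object, and isomorphism of squares. (It is not assumed for the square with two sides $\mathrm{id}_A$ and two sides $\Delta_A$.) 3. The projection formula holds: for $f:A\to B$, $M\in\mathscr C^B$, $N\in\mathscr C^A$ the canonical map $f_!(f^*M\otimes_A N)\to M\otimes_B f_!N$ is an isomorphism. Let $\mathscr C/\mathbf S$ be the bicategory whose 0-cells are the objects of $\mathbf S$, whose category of 1-cells $A\nrightarrow B$ and 2-cells between them is $\mathscr C^{A\times B}$, whose composition of $M:A\nrightarrow B$ and $N:B\nrightarrow D$ is $$M\odot N=(\pi_B)_!\big(\pi_D^*M\otimes_{A\times B\times D}\pi_A^*N\big)$$ (where $\pi_X$ denotes the projection of $A\times B\times D$ that omits the factor $X$), whose units are $U_A=(\Delta_A)_!I_A$, and whose associativity and unit constraints are the canonical isomorphisms given by the Beck--Chevalley isomorphisms, the projection formula, pseudofunctoriality of $(-)^*$ and $(-)_!$, and the monoidal constraints. A 1-cell $M:A\nrightarrow B$ is right dualizable, with right dual $N:B\nrightarrow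 A$, if there are 2-cells $\eta:U_A\to M\odot N$ and $\varepsilon:N\odot M\to U_B$ satisfying the two triangle identities. For $M\in\mathscr C^A$ let $\widehat M:A\nrightarrow\star$ and $\widecheck M:\star\nrightarrow A$ be the 1-cells obtained by reindexing $M$ along the canonical isomorphisms $A\times\star\cong A$ and $\star\times A\cong A$. **Theorem.** For every object $A$ of $\mathbf S$, an object $M\in\mathscr C^A$ is dualizable in the symmetric monoidal category $\mathscr C^A$ if and only if $\widehat M:A\nrightarrow\star$ is right dualizable in the bicategory $\mathscr C/\mathbf S$. Moreover, if $M^\star$ is a dual of $M$ in $\mathscr C^A$, then $\widecheck{M^\star}$ is a right dual of $\widehat M$, and every right dual of $\widehat M$ is isomorphic to $\widecheck{M^\star}$. -/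

import Mathlib

open CategoryTheory MonoidalCategory CartesianMonoidalCategory

universe w v u₁ u₂

noncomputable section

/-- An `S`-indexed symmetric monoidal category, in elementary terms: a pseudofunctor from `Sᵒᵖ` to
the 2-category of symmetric monoidal categories, strong symmetric monoidal functors and monoidal
natural transformations. `fib A` is the fiber category over `A`, and `pull f` is the reindexing
functor `f^*`. -/
structure IndexedSymMonCat (S : Type u₁) [Category.{w} S] where
  /-- the fiber categories -/
  fib : S → Type u₂
  [cat : ∀ A, Category.{v} (fib A)]
  [mon : ∀ A, MonoidalCategory (fib A)]
  [symm : ∀ A, SymmetricCategory (fib A)]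
  /-- the reindexing functor `f^*` -/
  pull : ∀ {A B : S}, (A ⟶ B) → fib B ⥤ fib A
  [pullBraided : ∀ {A B : S} (f : A ⟶ B), (pull f).Braided]
  /-- `(𝟙 A)^* ≅ 𝟭` -/
  pullId : ∀ A : S, pull (𝟙 A) ≅ 𝟭 (fib A)
  /-- `(f ≫ g)^* ≅ g^* ⋙ f^*` -/
  pullComp : ∀ {A B D : S} (f : A ⟶ B) (g : B ⟶ D), pull (f ≫ g) ≅ pull g ⋙ pull f
  [pullId_monoidal : ∀ A : S, NatTrans.IsMonoidal (pullId A).hom]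
  [pullComp_monoidal : ∀ {A B D : S} (f : A ⟶ B) (g : B ⟶ D),
    NatTrans.IsMonoidal (pullComp f g).hom]
  pull_id_comp : ∀ {A B : S} (f : A ⟶ B) (M : fib B),
    (pullComp (𝟙 A) f).hom.app M ≫ (pullId A).hom.app ((pull f).obj M) =
      eqToHom (by rw [Category.id_comp]; rfl)
  pull_comp_id : ∀ {A B : S} (f : A ⟶ B) (M : fib B),
    (pullComp f (𝟙 B)).hom.app M ≫ (pull f).map ((pullId B).hom.app M) =
      eqToHom (by rw [Category.comp_id]; rfl)
  pull_assoc : ∀ {A B D E : S} (f : A ⟶ B) (g : B ⟶ D) (h : D ⟶ E) (M : fib E),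
    (pullComp f (g ≫ h)).hom.app M ≫ (pull f).map ((pullComp g h).hom.app M) =
      eqToHom (by rw [Category.assoc]) ≫ (pullComp (f ≫ g) h).hom.app M ≫
        (pullComp f g).hom.app ((pull h).obj M)

namespace IndexedSymMonCat

attribute [instance] cat mon symm pullBraided pullId_monoidal pullComp_monoidal

variable {S : Type u₁} [Category.{w} S] (C : IndexedSymMonCat.{w, v, u₁, u₂} S)

/-- The isomorphism `f^* g^* ≅ k^*` for `k = f ≫ g`. -/
def pullTri {A B D : S} (f : A ⟶ B) (g : B ⟶ D) (k : A ⟶ D) (e : f ≫ g = k) :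
    C.pull g ⋙ C.pull f ≅ C.pull k :=
  (C.pullComp f g).symm ≪≫ eqToIso (by rw [e])

/-- The isomorphism `k^* ≅ 𝟭` for `k = 𝟙 A`. -/
def pullOne {A : S} (k : A ⟶ A) (e : k = 𝟙 A) : C.pull k ≅ 𝟭 (C.fib A) :=
  eqToIso (by rw [e]) ≪≫ C.pullId A

/-- Every reindexing functor `f^*` has a left adjoint `f_!`. -/
class HasPush : Prop where
  isRightAdjoint : ∀ {A B : S} (f : A ⟶ B), (C.pull f).IsRightAdjoint

attribute [instance] HasPush.isRightAdjoint

section Push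

variable [C.HasPush]

/-- The functor `f_!`, left adjoint to reindexing. -/
def push {A B : S} (f : A ⟶ B) : C.fib A ⥤ C.fib B := (C.pull f).leftAdjoint

/-- The adjunction `f_! ⊣ f^*`. -/
def adj {A B : S} (f : A ⟶ B) : C.push f ⊣ C.pull f := Adjunction.ofIsRightAdjoint (C.pull f)

/-- The isomorphism `g_! f_! ≅ k_!` for `k = f ≫ g`, the mate of `f^* g^* ≅ k^*`. -/
def pushTri {A B D : S} (f : A ⟶ B) (g : B ⟶ D) (k : A ⟶ D) (e : f ≫ g = k) :
    C.push f ⋙ C.push g ≅ C.push k :=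
  (conjugateIsoEquiv (C.adj k) ((C.adj f).comp (C.adj g))).symm (C.pullTri f g k e).symm

/-- The isomorphism `k_! ≅ 𝟭` for `k = 𝟙 A`, the mate of `k^* ≅ 𝟭`. -/
def pushOne {A : S} (k : A ⟶ A) (e : k = 𝟙 A) : C.push k ≅ 𝟭 (C.fib A) :=
  (conjugateIsoEquiv Adjunction.id (C.adj k)).symm (C.pullOne k e).symm

/-- The Beck-Chevalley map `f_! h^* ⟶ f_! h^* k^* k_! ≅ f_! f^* g^* k_! ⟶ g^* k_!` of a commutative
square with top `f`, left side `h`, right side `g` and bottom `k`. -/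
def beckChevalley {A B D E : S} {f : A ⟶ B} {h : A ⟶ D} {g : B ⟶ E} {k : D ⟶ E}
    (e : f ≫ g = h ≫ k) (M : C.fib D) :
    (C.push f).obj ((C.pull h).obj M) ⟶ (C.pull g).obj ((C.push k).obj M) :=
  (C.push f).map ((C.pull h).map ((C.adj k).unit.app M)) ≫
    (C.push f).map ((C.pullTri h k (f ≫ g) e.symm).hom.app ((C.push k).obj M)) ≫
    (C.push f).map ((C.pullTri f g (f ≫ g) rfl).inv.app ((C.push k).obj M)) ≫
    (C.adj f).counit.app ((C.pull g).obj ((C.push k).obj M))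

/-- The projection map `f_! (f^* M ⊗ N) ⟶ f_! (f^* M ⊗ f^* f_! N) ≅ f_! f^* (M ⊗ f_! N) ⟶ M ⊗ f_! N`. -/
def projection {A B : S} (f : A ⟶ B) (M : C.fib B) (N : C.fib A) :
    (C.push f).obj ((C.pull f).obj M ⊗ N) ⟶ M ⊗ (C.push f).obj N :=
  (C.push f).map ((C.pull f).obj M ◁ (C.adj f).unit.app N) ≫
    (C.push f).map (Functor.LaxMonoidal.μ (C.pull f) M ((C.push f).obj N)) ≫
    (C.adj f).counit.app (M ⊗ (C.push f).obj N)

/-- The mirror image `f_! (N ⊗ f^* M) ⟶ f_! N ⊗ M` of the projection map. -/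
def projection' {A B : S} (f : A ⟶ B) (N : C.fib A) (M : C.fib B) :
    (C.push f).obj (N ⊗ (C.pull f).obj M) ⟶ (C.push f).obj N ⊗ M :=
  (C.push f).map ((C.adj f).unit.app N ▷ (C.pull f).obj M) ≫
    (C.push f).map (Functor.LaxMonoidal.μ (C.pull f) ((C.push f).obj N) M) ≫
    (C.adj f).counit.app ((C.push f).obj N ⊗ M)

lemma projection'_eq {A B : S} (f : A ⟶ B) (N : C.fib A) (M : C.fib B) :
    C.projection' f N M =
      (C.push f).map (β_ N ((C.pull f).obj M)).hom ≫ C.projection f M N ≫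
        (β_ M ((C.push f).obj N)).hom := by
  have hn := (C.adj f).counit.naturality (β_ M ((C.push f).obj N)).hom
  simp only [Functor.comp_map, Functor.id_map] at hn
  have hβ := Functor.map_braiding (C.pull f) M ((C.push f).obj N)
  simp only [projection, projection', Category.assoc]
  erw [← hn]
  simp only [← Functor.map_comp_assoc]
  congr 2
  rw [hβ]
  simp

end Push

end IndexedSymMonCat

section Squares

variable {S : Type u₁} [Category.{w} S] [CartesianMonoidalCategory S]

/-- The squares for which the Beck-Chevalley condition is required; the arguments of
`BCSquare f h g k` are the top, left, right and bottom sides. They are generated from three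
families by transposition, product with a fixed object, and isomorphism of squares. (The square
with two identities and two diagonals is deliberately not among them.) -/
inductive BCSquare : ∀ {A B D E : S}, (A ⟶ B) → (A ⟶ D) → (B ⟶ E) → (D ⟶ E) → Prop
  /-- commutativity with reindexing -/
  | reindexing {A B D E : S} (f : A ⟶ B) (g : D ⟶ E) :
      BCSquare (f ▷ D) (A ◁ g) (B ◁ g) (f ▷ E)
  /-- the Frobenius axiom -/
  | frobenius (A : S) :
      BCSquare (lift (𝟙 A) (𝟙 A)) (lift (𝟙 A) (𝟙 A)) (A ◁ lift (𝟙 A) (𝟙 A))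
        ((lift (𝟙 A) (𝟙 A) ▷ A) ≫ (α_ A A A).hom)
  /-- sliding and splitting -/
  | sliding {A B : S} (f : A ⟶ B) :
      BCSquare (lift (𝟙 A) f) f (f ▷ B) (lift (𝟙 B) (𝟙 B))
  | transpose {A B D E : S} {f : A ⟶ B} {h : A ⟶ D} {g : B ⟶ E} {k : D ⟶ E} :
      BCSquare f h g k → BCSquare h f k g
  | prod (X : S) {A B D E : S} {f : A ⟶ B} {h : A ⟶ D} {g : B ⟶ E} {k : D ⟶ E} :
      BCSquare f h g k → BCSquare (X ◁ f) (X ◁ h) (X ◁ g) (X ◁ k)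
  | ofIso {A B D E A' B' D' E' : S} {f : A ⟶ B} {h : A ⟶ D} {g : B ⟶ E} {k : D ⟶ E}
      {f' : A' ⟶ B'} {h' : A' ⟶ D'} {g' : B' ⟶ E'} {k' : D' ⟶ E'}
      (a : A' ≅ A) (b : B' ≅ B) (d : D' ≅ D) (e : E' ≅ E)
      (hf : f' ≫ b.hom = a.hom ≫ f) (hh : h' ≫ d.hom = a.hom ≫ h)
      (hg : g' ≫ e.hom = b.hom ≫ g) (hk : k' ≫ e.hom = d.hom ≫ k) :
      BCSquare f h g k → BCSquare f' h' g' k'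

end Squares

namespace IndexedSymMonCat

variable {S : Type u₁} [Category.{w} S] [CartesianMonoidalCategory S]
  (C : IndexedSymMonCat.{w, v, u₁, u₂} S)

/-- `C` has indexed homotopy coproducts: the functors `f_!` exist, and the Beck-Chevalley maps of
the squares in `BCSquare` are isomorphisms. -/
class HasIndexedHomotopyCoproducts : Prop extends C.HasPush where
  isIso_beckChevalley : ∀ {A B D E : S} {f : A ⟶ B} {h : A ⟶ D} {g : B ⟶ E} {k : D ⟶ E}
    (e : f ≫ g = h ≫ k) (_ : BCSquare f h g k) (M : C.fib D), IsIso (C.beckChevalley e M)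

/-- The tensor product preserves indexed coproducts: the projection formula holds. -/
class TensorPreservesCoproducts [C.HasPush] : Prop where
  isIso_projection : ∀ {A B : S} (f : A ⟶ B) (M : C.fib B) (N : C.fib A),
    IsIso (C.projection f M N)

instance [C.HasPush] [C.TensorPreservesCoproducts] {A B : S} (f : A ⟶ B) (N : C.fib A)
    (M : C.fib B) : IsIso (C.projection' f N M) := by
  have := TensorPreservesCoproducts.isIso_projection (C := C) f M N
  rw [projection'_eq]
  infer_instance

lemma square_left (A B D E : S) :
    BCSquare (A ◁ snd B (D ⊗ E)) (A ◁ B ◁ fst D E) (A ◁ fst D E) (A ◁ snd B D) :=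
  .prod A (.ofIso (Iso.refl _) (λ_ _).symm (Iso.refl _) (λ_ _).symm (by ext <;> simp) (by ext <;> simp)
    (by ext <;> simp) (by ext <;> simp) (.reindexing (toUnit B) (fst D E)))

lemma square_right (A B D E : S) :
    BCSquare (A ◁ B ◁ snd D E) (snd A (B ⊗ (D ⊗ E))) (snd A (B ⊗ E)) (B ◁ snd D E) :=
  .ofIso (Iso.refl _) (Iso.refl _) (λ_ _).symm (λ_ _).symm (by ext <;> simp) (by ext <;> simp)
    (by ext <;> simp) (by ext <;> simp) (.transpose (.reindexing (toUnit A) (B ◁ snd D E)))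

lemma square_unit_left (A B : S) :
    BCSquare (lift (fst A B) (𝟙 (A ⊗ B))) (fst A B) (A ◁ fst A B) (lift (𝟙 A) (𝟙 A)) :=
  .ofIso (Iso.refl _) (α_ _ _ _).symm (ρ_ _).symm (ρ_ _).symm (by ext <;> simp) (by ext <;> simp)
    (by ext <;> simp) (by ext <;> simp) (.reindexing (lift (𝟙 A) (𝟙 A)) (toUnit B))

lemma square_unit_right (A B : S) :
    BCSquare (A ◁ lift (𝟙 B) (𝟙 B)) (snd A B) (snd A (B ⊗ B)) (lift (𝟙 B) (𝟙 B)) :=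
  .ofIso (Iso.refl _) (Iso.refl _) (λ_ _).symm (λ_ _).symm (by ext <;> simp) (by ext <;> simp)
    (by ext <;> simp) (by ext <;> simp) (.transpose (.reindexing (toUnit A) (lift (𝟙 B) (𝟙 B))))

/-- For a Beck-Chevalley square with sides `f, h, g, k`: `r_! (g^* k_! Y ⊗ Z) ≅ (f ≫ r)_! (h^* Y ⊗ f^* Z)`,
by the inverses of the Beck-Chevalley map and of the projection map. -/
def slideLeft [C.HasIndexedHomotopyCoproducts] [C.TensorPreservesCoproducts]
    {A B D E F : S} {f : A ⟶ B} {h : A ⟶ D} {g : B ⟶ E} {k : D ⟶ E}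
    (e : f ≫ g = h ≫ k) (sq : BCSquare f h g k) (r : B ⟶ F) (r' : A ⟶ F) (er : f ≫ r = r')
    (Y : C.fib D) (Z : C.fib B) :
    (C.push r).obj ((C.pull g).obj ((C.push k).obj Y) ⊗ Z) ≅
      (C.push r').obj ((C.pull h).obj Y ⊗ (C.pull f).obj Z) :=
  have := HasIndexedHomotopyCoproducts.isIso_beckChevalley (C := C) e sq Y
  (C.push r).mapIso (whiskerRightIso (asIso (C.beckChevalley e Y)).symm Z ≪≫
    (asIso (C.projection' f ((C.pull h).obj Y) Z)).symm) ≪≫ (C.pushTri f r r' er).app _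

/-- The mirror image `r_! (Z ⊗ g^* k_! Y) ≅ (f ≫ r)_! (f^* Z ⊗ h^* Y)` of `slideLeft`. -/
def slideRight [C.HasIndexedHomotopyCoproducts] [C.TensorPreservesCoproducts]
    {A B D E F : S} {f : A ⟶ B} {h : A ⟶ D} {g : B ⟶ E} {k : D ⟶ E}
    (e : f ≫ g = h ≫ k) (sq : BCSquare f h g k) (r : B ⟶ F) (r' : A ⟶ F) (er : f ≫ r = r')
    (Z : C.fib B) (Y : C.fib D) :
    (C.push r).obj (Z ⊗ (C.pull g).obj ((C.push k).obj Y)) ≅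
      (C.push r').obj ((C.pull f).obj Z ⊗ (C.pull h).obj Y) :=
  have := HasIndexedHomotopyCoproducts.isIso_beckChevalley (C := C) e sq Y
  have := TensorPreservesCoproducts.isIso_projection (C := C) f Z ((C.pull h).obj Y)
  (C.push r).mapIso (whiskerLeftIso Z (asIso (C.beckChevalley e Y)).symm ≪≫
    (asIso (C.projection f Z ((C.pull h).obj Y))).symm) ≪≫ (C.pushTri f r r' er).app _

/-! ### The bicategory `C/S`

Its 0-cells are the objects of `S`, its category of 1-cells and 2-cells from `A` to `B` is the
fiber `C.fib (A ⊗ B)` over the product, and its composition, units and constraints follow. -/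

/-- Composition of 1-cells `A ⇸ B` and `B ⇸ D`: `M ⊙ N = (π_B)_! (π_D^* M ⊗ π_A^* N)`, where the
projections are those of the product `A × (B × D)`. -/
def comp [C.HasPush] {A B D : S} (M : C.fib (A ⊗ B)) (N : C.fib (B ⊗ D)) : C.fib (A ⊗ D) :=
  (C.push (A ◁ snd B D)).obj
    ((C.pull (A ◁ fst B D)).obj M ⊗ (C.pull (snd A (B ⊗ D))).obj N)

/-- Composition on 2-cells. -/
def compMap [C.HasPush] {A B D : S} {M M' : C.fib (A ⊗ B)} {N N' : C.fib (B ⊗ D)}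
    (φ : M ⟶ M') (ψ : N ⟶ N') : C.comp M N ⟶ C.comp M' N' :=
  (C.push (A ◁ snd B D)).map
    ((C.pull (A ◁ fst B D)).map φ ⊗ₘ (C.pull (snd A (B ⊗ D))).map ψ)

/-- The unit 1-cell `U_A = (Δ_A)_! I_A`. -/
def unit [C.HasPush] (A : S) : C.fib (A ⊗ A) :=
  (C.push (lift (𝟙 A) (𝟙 A))).obj (𝟙_ (C.fib A))

section Bicategory

variable [C.HasIndexedHomotopyCoproducts] [C.TensorPreservesCoproducts]

/-- `(M ⊙ N) ⊙ P` as a single pushforward of a triple tensor product over `A × B × D × E`. -/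
def compCompLeft {A B D E : S} (M : C.fib (A ⊗ B)) (N : C.fib (B ⊗ D)) (P : C.fib (D ⊗ E)) :
    C.comp (C.comp M N) P ≅
      (C.push (A ◁ (snd B (D ⊗ E) ≫ snd D E))).obj
        (((C.pull (A ◁ fst B (D ⊗ E))).obj M ⊗
          (C.pull (snd A (B ⊗ (D ⊗ E)) ≫ B ◁ fst D E)).obj N) ⊗
          (C.pull (snd A (B ⊗ (D ⊗ E)) ≫ snd B (D ⊗ E))).obj P) :=
  C.slideLeft (f := A ◁ snd B (D ⊗ E)) (h := A ◁ B ◁ fst D E) (by ext <;> simp)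
      (square_left A B D E) (A ◁ snd D E) _ (by ext <;> simp) _ _ ≪≫
    (C.push _).mapIso
      (((Functor.Monoidal.μIso (C.pull (A ◁ B ◁ fst D E)) _ _).symm ≪≫
          ((C.pullTri (A ◁ B ◁ fst D E) (A ◁ fst B D) _ (by ext <;> simp)).app M ⊗ᵢ
            (C.pullTri (A ◁ B ◁ fst D E) (snd A (B ⊗ D)) _ (by ext <;> simp)).app N)) ⊗ᵢ
        (C.pullTri (A ◁ snd B (D ⊗ E)) (snd A (D ⊗ E)) _ (by ext <;> simp)).app P)

/-- `M ⊙ (N ⊙ P)` as a single pushforward of a triple tensor product over `A × B × D × E`. -/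
def compCompRight {A B D E : S} (M : C.fib (A ⊗ B)) (N : C.fib (B ⊗ D)) (P : C.fib (D ⊗ E)) :
    C.comp M (C.comp N P) ≅
      (C.push (A ◁ (snd B (D ⊗ E) ≫ snd D E))).obj
        ((C.pull (A ◁ fst B (D ⊗ E))).obj M ⊗
          ((C.pull (snd A (B ⊗ (D ⊗ E)) ≫ B ◁ fst D E)).obj N ⊗
          (C.pull (snd A (B ⊗ (D ⊗ E)) ≫ snd B (D ⊗ E))).obj P)) :=
  C.slideRight (f := A ◁ B ◁ snd D E) (h := snd A (B ⊗ (D ⊗ E))) (by ext <;> simp)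
      (square_right A B D E) (A ◁ snd B E) _ (by ext <;> simp) _ _ ≪≫
    (C.push _).mapIso
      ((C.pullTri (A ◁ B ◁ snd D E) (A ◁ fst B E) _ (by ext <;> simp)).app M ⊗ᵢ
        ((Functor.Monoidal.μIso (C.pull (snd A (B ⊗ (D ⊗ E)))) _ _).symm ≪≫
          ((C.pullTri (snd A (B ⊗ (D ⊗ E))) (B ◁ fst D E) _ rfl).app N ⊗ᵢ
            (C.pullTri (snd A (B ⊗ (D ⊗ E))) (snd B (D ⊗ E)) _ rfl).app P)))

/-- The associativity constraint `(M ⊙ N) ⊙ P ≅ M ⊙ (N ⊙ P)`. -/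
def assoc {A B D E : S} (M : C.fib (A ⊗ B)) (N : C.fib (B ⊗ D)) (P : C.fib (D ⊗ E)) :
    C.comp (C.comp M N) P ≅ C.comp M (C.comp N P) :=
  C.compCompLeft M N P ≪≫ (C.push _).mapIso (α_ _ _ _) ≪≫ (C.compCompRight M N P).symm

/-- The left unit constraint `U_A ⊙ M ≅ M`. -/
def leftUnit {A B : S} (M : C.fib (A ⊗ B)) : C.comp (C.unit A) M ≅ M :=
  C.slideLeft (f := lift (fst A B) (𝟙 (A ⊗ B))) (h := fst A B) (by ext <;> simp)
      (square_unit_left A B) (A ◁ snd A B) (𝟙 (A ⊗ B)) (by ext <;> simp) _ _ ≪≫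
    (C.pushOne _ rfl).app _ ≪≫
    ((Functor.Monoidal.εIso (C.pull (fst A B))).symm ⊗ᵢ
      ((C.pullTri (lift (fst A B) (𝟙 (A ⊗ B))) (snd A (A ⊗ B)) (𝟙 (A ⊗ B)) (by simp)).app M ≪≫
        (C.pullOne _ rfl).app M)) ≪≫
    λ_ M

/-- The right unit constraint `M ⊙ U_B ≅ M`. -/
def rightUnit {A B : S} (M : C.fib (A ⊗ B)) : C.comp M (C.unit B) ≅ M :=
  C.slideRight (f := A ◁ lift (𝟙 B) (𝟙 B)) (h := snd A B) (by ext <;> simp)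
      (square_unit_right A B) (A ◁ snd B B) (𝟙 (A ⊗ B)) (by ext <;> simp) _ _ ≪≫
    (C.pushOne _ rfl).app _ ≪≫
    (((C.pullTri (A ◁ lift (𝟙 B) (𝟙 B)) (A ◁ fst B B) (𝟙 (A ⊗ B)) (by ext <;> simp)).app M ≪≫
        (C.pullOne _ rfl).app M) ⊗ᵢ
      (Functor.Monoidal.εIso (C.pull (snd A B))).symm) ≪≫
    ρ_ M

/-- The structure making the 1-cell `N : B ⇸ A` a right dual of the 1-cell `M : A ⇸ B` in the
bicategory `C/S`. -/
structure RightDual {A B : S} (M : C.fib (A ⊗ B)) (N : C.fib (B ⊗ A)) where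
  /-- the coevaluation `U_A ⟶ M ⊙ N` -/
  coev : C.unit A ⟶ C.comp M N
  /-- the evaluation `N ⊙ M ⟶ U_B` -/
  ev : C.comp N M ⟶ C.unit B
  triangle_left : (C.leftUnit M).inv ≫ C.compMap coev (𝟙 M) ≫ (C.assoc M N M).hom ≫
    C.compMap (𝟙 M) ev ≫ (C.rightUnit M).hom = 𝟙 M
  triangle_right : (C.rightUnit N).inv ≫ C.compMap (𝟙 N) coev ≫ (C.assoc N M N).inv ≫
    C.compMap ev (𝟙 N) ≫ (C.leftUnit N).hom = 𝟙 N

/-- The 1-cell `M : A ⇸ B` is right dualizable in the bicategory `C/S`. -/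
def IsRightDualizable {A B : S} (M : C.fib (A ⊗ B)) : Prop :=
  ∃ N : C.fib (B ⊗ A), Nonempty (C.RightDual M N)

end Bicategory

/-- An object of the fiber over `A` is dualizable in the symmetric monoidal category `C.fib A`. -/
def IsDualizable {A : S} (M : C.fib A) : Prop :=
  ∃ D : C.fib A, Nonempty (ExactPairing M D)

/-- `M` over `A` as a 1-cell `A ⇸ ⋆`, by reindexing along `A × ⋆ ≅ A`. -/
def hat {A : S} (M : C.fib A) : C.fib (A ⊗ 𝟙_ S) := (C.pull (ρ_ A).hom).obj M

/-- `M` over `A` as a 1-cell `⋆ ⇸ A`, by reindexing along `⋆ × A ≅ A`. -/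
def check {A : S} (M : C.fib A) : C.fib (𝟙_ S ⊗ A) := (C.pull (λ_ A).hom).obj M

end IndexedSymMonCat
end

/-! The argument takes place in the total category (Grothendieck construction) of `C`. There
reindexing is encoded by cartesian morphisms, pushforward by cocartesian ones and the fiberwise
tensor by `tens`, so mates and coherence isomorphisms become equations between composites. Morphisms
φ over (a, b) and ψ over (b, d) into 1-cells M and N induce a morphism `pair φ ψ` over (a, d) into M
⊙ N. On such pairs the constraints of the bicategory act as the associator and unitors of a single
fiber: `pair_pair_assoc`, `pair_unit_left`, `pair_unit_right`.

Let K : A ⇸ ⋆ correspond to M, and N : ⋆ ⇸ A to D, under A × ⋆ ≅ A ≅ ⋆ × A. Since K ⊙ N is a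
pushforward along the isomorphism A × (⋆ × A) ≅ A × A, it is the external product of M and D. A
2-cell U_A → K ⊙ N is therefore a map from I_A to this product over Δ_A, that is, a map I_A → M ⊗ D.
Dually, N ⊙ K is the pushforward of D ⊗ M to the point and U_⋆ is I_⋆ up to isomorphism, so a 2-cell
N ⊙ K → U_⋆ is a map D ⊗ M → I_A.

Under these correspondences the triangle composites of the bicategory are conjugate to those of the
fiber (`triangle_left_comparison`, `triangle_right_comparison`), so both kinds of duality data
agree. Every 1-cell ⋆ ⇸ A arises from some D, which gives the converse; uniqueness of duals in the
fiber gives uniqueness of right duals. -/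

noncomputable section

namespace IndexedSymMonCat

/-! ### The total category of an indexed category. -/

section Total

variable {S : Type u₁} [Category.{w} S] (C : IndexedSymMonCat.{w, v, u₁, u₂} S)

/-- Objects of the total category: an object of the base with an object of the fiber over it. -/
structure Tot where
  /-- the underlying object of the base -/
  base : S
  /-- the object of the fiber -/
  fib : C.fib base

variable {C}

/-- Morphisms of the total category: a morphism `f` of the base with a morphism into the
reindexing of the target along `f`. -/
structure Tot.Hom (X Y : C.Tot) where
  /-- the underlying morphism of the base -/
  base : X.base ⟶ Y.base
  /-- the morphism of the fiber -/
  fib : X.fib ⟶ (C.pull base).obj Y.fib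

lemma Tot.Hom.ext_fib {X Y : C.Tot} {φ ψ : Tot.Hom X Y} (h : φ.base = ψ.base)
    (h' : φ.fib ≫ eqToHom (by rw [h]) = ψ.fib) : φ = ψ := by
  obtain ⟨f, a⟩ := φ
  obtain ⟨g, b⟩ := ψ
  dsimp at h
  subst h
  simp at h'
  rw [h']

/-- Composition in the total category uses the inverse of `pullComp`, so the three coherence axioms
of the pseudofunctor are needed in inverted form. -/
lemma pull_id_comp_inv {A B : S} (f : A ⟶ B) (M : C.fib B) :
    (C.pullId A).inv.app ((C.pull f).obj M) ≫ (C.pullComp (𝟙 A) f).inv.app M =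
      eqToHom (by rw [Category.id_comp]; rfl) := by
  have h := C.pull_id_comp f M
  apply (cancel_epi ((C.pullId A).hom.app ((C.pull f).obj M))).1
  apply (cancel_epi ((C.pullComp (𝟙 A) f).hom.app M)).1
  rw [Iso.hom_inv_id_app_assoc]
  erw [Iso.hom_inv_id_app, reassoc_of% h]
  simp

lemma pull_comp_id_inv {A B : S} (f : A ⟶ B) (M : C.fib B) :
    (C.pull f).map ((C.pullId B).inv.app M) ≫ (C.pullComp f (𝟙 B)).inv.app M =
      eqToHom (by rw [Category.comp_id]; rfl) := by
  have h := C.pull_comp_id f M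
  apply (cancel_epi ((C.pull f).map ((C.pullId B).hom.app M))).1
  apply (cancel_epi ((C.pullComp f (𝟙 B)).hom.app M)).1
  rw [← Functor.map_comp_assoc, Iso.hom_inv_id_app]
  erw [CategoryTheory.Functor.map_id, Category.id_comp, Iso.hom_inv_id_app, reassoc_of% h]
  simp

lemma pull_assoc_inv {A B D E : S} (f : A ⟶ B) (g : B ⟶ D) (h : D ⟶ E) (M : C.fib E) :
    (C.pull f).map ((C.pullComp g h).inv.app M) ≫ (C.pullComp f (g ≫ h)).inv.app M =
      (C.pullComp f g).inv.app ((C.pull h).obj M) ≫ (C.pullComp (f ≫ g) h).inv.app M ≫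
        eqToHom (by rw [Category.assoc]) := by
  have H := C.pull_assoc f g h M
  apply (cancel_epi ((C.pull f).map ((C.pullComp g h).hom.app M))).1
  apply (cancel_epi ((C.pullComp f (g ≫ h)).hom.app M)).1
  rw [← Functor.map_comp_assoc, Iso.hom_inv_id_app]
  erw [CategoryTheory.Functor.map_id, Category.id_comp, Iso.hom_inv_id_app, reassoc_of% H]
  erw [Iso.hom_inv_id_app_assoc, Iso.hom_inv_id_app_assoc]
  simp

/-- The category laws are the coherence axioms of the pseudofunctor, combined with naturality of
`pullId` and `pullComp`. -/
instance : Category C.Tot where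
  Hom := Tot.Hom
  id X := ⟨𝟙 _, (C.pullId _).inv.app _⟩
  comp {X Y Z} φ ψ := ⟨φ.base ≫ ψ.base,
    φ.fib ≫ (C.pull φ.base).map ψ.fib ≫ (C.pullComp φ.base ψ.base).inv.app _⟩
  id_comp {X Y} φ := by
    refine Tot.Hom.ext_fib (Category.id_comp _) ?_
    have hn := (C.pullId X.base).inv.naturality φ.fib
    dsimp at hn ⊢
    simp only [Category.assoc]
    rw [← reassoc_of% hn, reassoc_of% (pull_id_comp_inv φ.base Y.fib)]
    simp
  comp_id {X Y} φ := by
    refine Tot.Hom.ext_fib (Category.comp_id _) ?_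
    dsimp
    simp only [Category.assoc]
    rw [reassoc_of% (pull_comp_id_inv φ.base Y.fib)]
    simp
  assoc {X Y Z W} φ ψ χ := by
    refine Tot.Hom.ext_fib (Category.assoc _ _ _) ?_
    have hn := (C.pullComp φ.base ψ.base).inv.naturality χ.fib
    dsimp at hn ⊢
    simp only [Category.assoc, Functor.map_comp]
    rw [pull_assoc_inv, ← reassoc_of% hn]

/-- The object of the total category given by an object of a fiber. -/
abbrev tot {A : S} (M : C.fib A) : C.Tot := ⟨A, M⟩

/-- The morphism of the base underlying a morphism of the total category. -/
def bs {A B : S} {M : C.fib A} {N : C.fib B} (φ : tot M ⟶ tot N) : A ⟶ B := Tot.Hom.base φ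

@[simp] lemma id_base {A : S} (M : C.fib A) : bs (𝟙 (tot M)) = 𝟙 A := (rfl)

@[simp] lemma comp_base {A B D : S} {M : C.fib A} {N : C.fib B} {P : C.fib D}
    (φ : tot M ⟶ tot N) (ψ : tot N ⟶ tot P) : bs (φ ≫ ψ) = bs φ ≫ bs ψ := (rfl)

/-- The morphism of the total category over `f` given by a morphism into a reindexing along `f`. -/
def overHom {A B : S} {M : C.fib A} {N : C.fib B} (f : A ⟶ B) (φ : M ⟶ (C.pull f).obj N) :
    tot M ⟶ tot N := ⟨f, φ⟩

@[simp] lemma over_base {A B : S} {M : C.fib A} {N : C.fib B} (f : A ⟶ B)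
    (φ : M ⟶ (C.pull f).obj N) : bs (overHom f φ) = f := (rfl)

lemma over_comp {A B D : S} {M : C.fib A} {N : C.fib B} {P : C.fib D} (f : A ⟶ B) (g : B ⟶ D)
    (k : A ⟶ D) (e : f ≫ g = k) (φ : M ⟶ (C.pull f).obj N) (ψ : N ⟶ (C.pull g).obj P) :
    overHom f φ ≫ overHom g ψ =
      overHom k (φ ≫ (C.pull f).map ψ ≫ (C.pullTri f g k e).hom.app P) := by
  subst e
  simp [pullTri]
  rfl

lemma over_inj {A B : S} {M : C.fib A} {N : C.fib B} (f : A ⟶ B)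
    {φ ψ : M ⟶ (C.pull f).obj N} (h : overHom f φ = overHom f ψ) : φ = ψ := by
  injection h with _ h

lemma exists_over {A B : S} {M : C.fib A} {N : C.fib B} (φ : tot M ⟶ tot N) (f : A ⟶ B)
    (h : bs φ = f) : ∃ a, φ = overHom f a := by
  subst h
  exact ⟨Tot.Hom.fib φ, rfl⟩

/-- A morphism of a fiber as a morphism of the total category. -/
def vert {A : S} {M N : C.fib A} (φ : M ⟶ N) : tot M ⟶ tot N :=
  overHom (𝟙 A) (φ ≫ (C.pullId A).inv.app N)

@[simp] lemma vert_base {A : S} {M N : C.fib A} (φ : M ⟶ N) : bs (vert φ) = 𝟙 A := (rfl)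

@[simp] lemma vert_id {A : S} (M : C.fib A) : vert (𝟙 M) = 𝟙 (tot M) := by
  simp [vert]; rfl

/-- Each fiber embeds faithfully; this brings equations proved in the total category back to the
fiber. -/
lemma vert_injective {A : S} {M N : C.fib A} {φ ψ : M ⟶ N} (h : vert φ = vert ψ) : φ = ψ := by
  have := over_inj _ h
  exact (cancel_mono _).1 this

lemma vert_comp_over {A B : S} {M M' : C.fib A} {N : C.fib B} (φ : M ⟶ M') (f : A ⟶ B)
    (ψ : M' ⟶ (C.pull f).obj N) : vert φ ≫ overHom f ψ = overHom f (φ ≫ ψ) := by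
  have hn := (C.pullId A).inv.naturality ψ
  dsimp at hn
  rw [vert, over_comp (e := Category.id_comp f)]
  congr 1
  simp only [Category.assoc, pullTri]
  rw [← reassoc_of% hn]
  have := pull_id_comp_inv f N
  simp only [Iso.trans_hom, Iso.symm_hom, NatTrans.comp_app, reassoc_of% this]
  simp

lemma over_comp_vert {A B : S} {M : C.fib A} {N N' : C.fib B} (f : A ⟶ B)
    (φ : M ⟶ (C.pull f).obj N) (ψ : N ⟶ N') :
    overHom f φ ≫ vert ψ = overHom f (φ ≫ (C.pull f).map ψ) := by
  rw [vert, over_comp (e := Category.comp_id f)]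
  congr 1
  have := pull_comp_id_inv f N'
  simp only [pullTri, Iso.trans_hom, Iso.symm_hom, NatTrans.comp_app, reassoc_of% this,
    Functor.map_comp, Category.assoc]
  simp

lemma vert_comp {A : S} {M N P : C.fib A} (φ : M ⟶ N) (ψ : N ⟶ P) :
    vert (φ ≫ ψ) = vert φ ≫ vert ψ := by
  conv_rhs => rw [vert, over_comp_vert]
  rw [vert]
  congr 1
  simp [← (C.pullId A).inv.naturality ψ]

/-- An isomorphism of a fiber as an isomorphism of the total category. -/
@[simps] def vertIso {A : S} {M N : C.fib A} (i : M ≅ N) : tot M ≅ tot N where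
  hom := vert i.hom
  inv := vert i.inv
  hom_inv_id := by rw [← vert_comp, Iso.hom_inv_id, vert_id]
  inv_hom_id := by rw [← vert_comp, Iso.inv_hom_id, vert_id]

lemma exists_vert {A : S} {M N : C.fib A} (φ : tot M ⟶ tot N) (h : bs φ = 𝟙 A) :
    ∃ a, φ = vert a := by
  obtain ⟨a, rfl⟩ := exists_over φ _ h
  exact ⟨a ≫ (C.pullId A).hom.app N, by simp [vert]⟩

/-! ### Cartesian morphisms -/

/-- The cartesian morphism `f^* N ⟶ N` over `f`. -/
def cart {A B : S} (f : A ⟶ B) (N : C.fib B) : tot ((C.pull f).obj N) ⟶ tot N :=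
  overHom f (𝟙 _)

@[simp] lemma cart_base {A B : S} (f : A ⟶ B) (N : C.fib B) :
    bs (cart f N) = f := (rfl)

lemma vert_comp_cart {A B : S} (f : A ⟶ B) {M : C.fib A} {N : C.fib B}
    (φ : M ⟶ (C.pull f).obj N) : vert φ ≫ cart f N = overHom f φ := by
  rw [cart, vert_comp_over, Category.comp_id]

lemma vert_pull_map {A B : S} (f : A ⟶ B) {N N' : C.fib B} (φ : N ⟶ N') :
    vert ((C.pull f).map φ) ≫ cart f N' = cart f N ≫ vert φ := by
  rw [vert_comp_cart, cart, over_comp_vert, Category.id_comp]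

lemma overHom_comp_cart {A B D : S} {M : C.fib A} {N : C.fib D} (f : A ⟶ B) (g : B ⟶ D)
    (k : A ⟶ D) (e : f ≫ g = k) (φ : M ⟶ (C.pull f).obj ((C.pull g).obj N)) :
    overHom f φ ≫ cart g N = overHom k (φ ≫ (C.pullTri f g k e).hom.app N) := by
  rw [cart, over_comp f g k e, CategoryTheory.Functor.map_id, Category.id_comp]

lemma vert_pullTri {A B D : S} (f : A ⟶ B) (g : B ⟶ D) (k : A ⟶ D) (e : f ≫ g = k)
    (M : C.fib D) : vert ((C.pullTri f g k e).hom.app M) ≫ cart k M =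
      cart f ((C.pull g).obj M) ≫ cart g M := by
  rw [vert_comp_cart]
  conv_rhs => rw [cart, overHom_comp_cart f g k e, Category.id_comp]

lemma vert_pullTri_inv {A B D : S} (f : A ⟶ B) (g : B ⟶ D) (k : A ⟶ D)
    (e : f ≫ g = k) (M : C.fib D) :
    vert ((C.pullTri f g k e).inv.app M) ≫ cart f ((C.pull g).obj M) ≫ cart g M =
      cart k M := by
  rw [← vert_pullTri f g k e, ← reassoc_of% (vert_comp (C := C)), Iso.inv_hom_id_app]
  simp

lemma vert_pullOne {A : S} (k : A ⟶ A) (e : k = 𝟙 A) (M : C.fib A) :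
    vert ((C.pullOne k e).hom.app M) = cart k M := by
  subst e
  rw [vert, cart, pullOne]
  simp

lemma vert_pullOne_inv {A : S} (k : A ⟶ A) (e : k = 𝟙 A) (M : C.fib A) :
    vert (M := M) ((C.pullOne k e).inv.app M) ≫ cart k M = 𝟙 (tot M) := by
  rw [← vert_pullOne k e, ← vert_id]
  erw [← vert_comp]
  rw [Iso.inv_hom_id_app]
  rfl

/-- The factorization of a morphism of the total category through a cartesian morphism. -/
lemma exists_cartLift {A' A B : S} {M : C.fib A'} {N : C.fib B} (f : A ⟶ B)
    (φ : tot M ⟶ tot N) (g : A' ⟶ A) (h : g ≫ f = bs φ) :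
    ∃ a : tot M ⟶ tot ((C.pull f).obj N), bs a = g ∧ a ≫ cart f N = φ := by
  obtain ⟨a, rfl⟩ := exists_over φ _ h.symm
  refine ⟨overHom g (a ≫ (C.pullTri g f _ rfl).inv.app N), rfl, ?_⟩
  rw [overHom_comp_cart g f _ rfl, Category.assoc, Iso.inv_hom_id_app]
  simp

/-- The factorization of a morphism of the total category through a cartesian morphism. -/
def cartLift {A' A B : S} {M : C.fib A'} {N : C.fib B} (f : A ⟶ B)
    (φ : tot M ⟶ tot N) (g : A' ⟶ A) (h : g ≫ f = bs φ) :
    tot M ⟶ tot ((C.pull f).obj N) := (exists_cartLift f φ g h).choose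

@[simp] lemma cartLift_base {A' A B : S} {M : C.fib A'} {N : C.fib B} (f : A ⟶ B)
    (φ : tot M ⟶ tot N) (g : A' ⟶ A) (h : g ≫ f = bs φ) :
    bs (cartLift f φ g h) = g := (exists_cartLift f φ g h).choose_spec.1

@[simp] lemma cartLift_cart {A' A B : S} {M : C.fib A'} {N : C.fib B}
    (f : A ⟶ B) (φ : tot M ⟶ tot N) (g : A' ⟶ A) (h : g ≫ f = bs φ) :
    cartLift f φ g h ≫ cart f N = φ := (exists_cartLift f φ g h).choose_spec.2

/-- The uniqueness half of the cartesian property; `exists_cartLift` is the existence half. -/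
lemma cart_ext {A' A B : S} {f : A ⟶ B} {M : C.fib A'} {N : C.fib B}
    {a b : tot M ⟶ tot ((C.pull f).obj N)} (h : bs a = bs b)
    (h' : a ≫ cart f N = b ≫ cart f N) : a = b := by
  obtain ⟨g, a⟩ := a
  obtain ⟨g', b⟩ := b
  obtain rfl : g = g' := h
  change overHom g a ≫ cart f N = overHom g b ≫ cart f N at h'
  rw [overHom_comp_cart _ f _ rfl, overHom_comp_cart _ f _ rfl] at h'
  rw [(cancel_mono _).1 (over_inj _ h')]

/-! ### Cocartesian morphisms -/

section

variable [C.HasPush]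

/-- The cocartesian morphism `M ⟶ f_! M` over `f`. -/
def cocart {A B : S} (f : A ⟶ B) (M : C.fib A) : tot M ⟶ tot ((C.push f).obj M) :=
  overHom f ((C.adj f).unit.app M)

@[simp] lemma cocart_base {A B : S} (f : A ⟶ B) (M : C.fib A) :
    bs (cocart f M) = f := (rfl)

lemma cocart_comp_vert {A B : S} (f : A ⟶ B) {M : C.fib A} {N : C.fib B}
    (φ : (C.push f).obj M ⟶ N) :
    cocart f M ≫ vert φ = overHom f ((C.adj f).homEquiv M N φ) := by
  rw [cocart, over_comp_vert, Adjunction.homEquiv_unit]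

lemma vert_push_map {A B : S} (f : A ⟶ B) {M M' : C.fib A} (φ : M ⟶ M') :
    cocart f M ≫ vert ((C.push f).map φ) = vert φ ≫ cocart f M' := by
  rw [cocart, over_comp_vert, cocart, vert_comp_over]
  congr 1
  exact ((C.adj f).unit.naturality φ).symm

lemma vert_unit {A B : S} (f : A ⟶ B) (M : C.fib A) :
    vert ((C.adj f).unit.app M) ≫ cart f ((C.push f).obj M) = cocart f M :=
  vert_comp_cart _ _

lemma vert_counit {A B : S} (f : A ⟶ B) (N : C.fib B) :
    cocart f ((C.pull f).obj N) ≫ vert ((C.adj f).counit.app N) = cart f N := by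
  rw [cocart_comp_vert, cart]
  congr 1
  simp [Adjunction.homEquiv_unit]

/-- Injectivity of the hom-bijection of f_! ⊣ f^*; the next lemma is its surjectivity. Testing
against vertical maps is enough, as 2-cells are vertical. -/
lemma cocart_ext_vert {A B : S} {f : A ⟶ B} {M : C.fib A} {N : C.fib B}
    {a b : (C.push f).obj M ⟶ N} (h : cocart f M ≫ vert a = cocart f M ≫ vert b) : a = b := by
  rw [cocart_comp_vert, cocart_comp_vert] at h
  exact ((C.adj f).homEquiv M N).injective (over_inj _ h)

lemma exists_cocartDesc {A B : S} (f : A ⟶ B) {M : C.fib A} {N : C.fib B}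
    (φ : tot M ⟶ tot N) (h : bs φ = f) :
    ∃ a, cocart f M ≫ vert a = φ := by
  obtain ⟨a, rfl⟩ := exists_over φ _ h
  exact ⟨((C.adj f).homEquiv M N).symm a, by rw [cocart_comp_vert, Equiv.apply_symm_apply]⟩

/-- `pushTri` is a mate, hence determined by the units of the adjunctions, and those units are the
cocartesian morphisms. -/
lemma vert_pushTri {A B D : S} (f : A ⟶ B) (g : B ⟶ D) (k : A ⟶ D) (e : f ≫ g = k)
    (M : C.fib A) :
    cocart f M ≫ cocart g _ ≫ vert ((C.pushTri f g k e).hom.app M) = cocart k M := by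
  have := unit_conjugateEquiv_symm (C.adj k) ((C.adj f).comp (C.adj g))
    (C.pullTri f g k e).inv M
  rw [cocart_comp_vert, cocart, over_comp f g k e, cocart]
  congr 1
  rw [← cancel_mono ((C.pullTri f g k e).inv.app _), this]
  have hp : (C.pushTri f g k e).hom =
    (conjugateEquiv (C.adj k) ((C.adj f).comp (C.adj g))).symm (C.pullTri f g k e).inv := rfl
  rw [← hp, Adjunction.comp_unit_app, Adjunction.homEquiv_unit]
  simp

lemma vert_pushOne {A : S} (k : A ⟶ A) (e : k = 𝟙 A) (M : C.fib A) :
    cocart k M ≫ vert (N := M) ((C.pushOne k e).hom.app M) = 𝟙 (tot M) := by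
  have := unit_conjugateEquiv_symm Adjunction.id (C.adj k) (C.pullOne k e).inv M
  have hp : (C.pushOne k e).hom =
    (conjugateEquiv Adjunction.id (C.adj k)).symm (C.pullOne k e).inv := rfl
  rw [← hp] at this
  rw [cocart_comp_vert, Adjunction.homEquiv_unit]
  erw [← this]
  rw [← vert_comp_cart, ← vert_pullOne k e M]
  erw [← vert_comp]
  simp

lemma vert_pushOne_inv {A : S} (k : A ⟶ A) (e : k = 𝟙 A) (M : C.fib A) :
    vert (M := M) ((C.pushOne k e).inv.app M) = cocart k M := by
  have h := (vertIso (N := M) ((C.pushOne k e).app M)).comp_inv_eq.2 (vert_pushOne k e M).symm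
  exact (Category.id_comp _).symm.trans h

end

/-! ### Tensor products of morphisms with the same underlying morphism of the base -/

/-- The tensor product of two morphisms of the total category over the same morphism. -/
def tens {A B : S} {M N : C.fib A} {M' N' : C.fib B} (φ : tot M ⟶ tot M') (ψ : tot N ⟶ tot N')
    (h : bs ψ = bs φ) : tot (M ⊗ N) ⟶ tot (M' ⊗ N') :=
  -- The base of ψ equals that of φ only propositionally, so ψ is first rewritten as a morphism over
  -- `bs φ`.
  overHom (bs φ) ((Tot.Hom.fib φ ⊗ₘ (exists_over ψ _ h).choose) ≫
    Functor.LaxMonoidal.μ (C.pull (bs φ)) _ _)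

@[simp] lemma tens_base {A B : S} {M N : C.fib A} {M' N' : C.fib B} (φ : tot M ⟶ tot M')
    (ψ : tot N ⟶ tot N') (h : bs ψ = bs φ) :
    bs (tens φ ψ h) = bs φ := (rfl)

lemma tens_over {A B : S} {M N : C.fib A} {M' N' : C.fib B} (f : A ⟶ B)
    (φ : M ⟶ (C.pull f).obj M') (ψ : N ⟶ (C.pull f).obj N') (h) :
    tens (overHom f φ) (overHom f ψ) h =
      overHom f ((φ ⊗ₘ ψ) ≫ Functor.LaxMonoidal.μ (C.pull f) _ _) := by
  have := (exists_over (overHom f ψ) _ h).choose_spec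
  rw [tens, ← over_inj _ this]
  rfl

lemma exists_over₂ {A B : S} {M N : C.fib A} {M' N' : C.fib B} (φ : tot M ⟶ tot M')
    (ψ : tot N ⟶ tot N') (h : bs ψ = bs φ) :
    ∃ f a b, φ = overHom f a ∧ ψ = overHom f b := by
  obtain ⟨b, hb⟩ := exists_over ψ _ h
  exact ⟨_, _, b, rfl, hb⟩

lemma pullTri_μ {A B D : S} (f : A ⟶ B) (g : B ⟶ D) (k : A ⟶ D) (e : f ≫ g = k)
    (M N : C.fib D) :
    Functor.LaxMonoidal.μ (C.pull f) ((C.pull g).obj M) ((C.pull g).obj N) ≫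
      (C.pull f).map (Functor.LaxMonoidal.μ (C.pull g) M N) ≫
        (C.pullTri f g k e).hom.app (M ⊗ N) =
      ((C.pullTri f g k e).hom.app M ⊗ₘ (C.pullTri f g k e).hom.app N) ≫
        Functor.LaxMonoidal.μ (C.pull k) M N := by
  subst e
  have := NatTrans.IsMonoidal.tensor (τ := (C.pullComp f g).inv) M N
  simpa [pullTri] using this

lemma pullTri_ε {A B D : S} (f : A ⟶ B) (g : B ⟶ D) (k : A ⟶ D) (e : f ≫ g = k) :
    Functor.LaxMonoidal.ε (C.pull f) ≫ (C.pull f).map (Functor.LaxMonoidal.ε (C.pull g)) ≫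
        (C.pullTri f g k e).hom.app (𝟙_ _) = Functor.LaxMonoidal.ε (C.pull k) := by
  subst e
  have := NatTrans.IsMonoidal.unit (τ := (C.pullComp f g).inv)
  simpa [pullTri] using this

/-- Functoriality of the fiberwise tensor comes from monoidality of `pullComp` and naturality of μ.
-/
lemma tens_comp {A B D : S} {M N : C.fib A} {M' N' : C.fib B} {M'' N'' : C.fib D}
    (φ : tot M ⟶ tot M') (ψ : tot N ⟶ tot N') (h : bs ψ = bs φ)
    (φ' : tot M' ⟶ tot M'') (ψ' : tot N' ⟶ tot N'') (h' : bs ψ' = bs φ') :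
    tens φ ψ h ≫ tens φ' ψ' h' = tens (φ ≫ φ') (ψ ≫ ψ') (by simp [h, h']) := by
  obtain ⟨f, φ, ψ, rfl, rfl⟩ := exists_over₂ φ ψ h
  obtain ⟨g, φ', ψ', rfl, rfl⟩ := exists_over₂ φ' ψ' h'
  simp only [over_comp f g _ rfl, tens_over]
  congr 1
  have := pullTri_μ f g _ rfl M'' N''
  simp only [Functor.map_comp, Category.assoc, ← tensorHom_comp_tensorHom, this,
    ← Functor.LaxMonoidal.μ_natural_assoc]

lemma tens_vert {A : S} {M N M' N' : C.fib A} (φ : M ⟶ M') (ψ : N ⟶ N') :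
    tens (vert φ) (vert ψ) (by simp) = vert (φ ⊗ₘ ψ) := by
  have := NatTrans.IsMonoidal.tensor (τ := (C.pullId A).inv) M' N'
  simp only [vert, tens_over]
  congr 1
  simp at this
  simp [this]

lemma tens_congr {A B : S} {M N : C.fib A} {M' N' : C.fib B} {φ φ' : tot M ⟶ tot M'}
    {ψ ψ' : tot N ⟶ tot N'} (h : bs ψ = bs φ) (hφ : φ = φ') (hψ : ψ = ψ') :
    tens φ ψ h = tens φ' ψ' (by rw [← hφ, ← hψ, h]) := by
  subst hφ; subst hψ; rfl

/-- The morphism between the unit objects over a morphism of the base. -/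
def unitMap {A B : S} (f : A ⟶ B) : tot (𝟙_ (C.fib A)) ⟶ tot (𝟙_ (C.fib B)) :=
  overHom f (Functor.LaxMonoidal.ε (C.pull f))

@[simp] lemma unitMap_base {A B : S} (f : A ⟶ B) :
    bs (unitMap (C := C) f) = f := (rfl)

lemma unitMap_comp {A B D : S} (f : A ⟶ B) (g : B ⟶ D) :
    unitMap (C := C) f ≫ unitMap g = unitMap (f ≫ g) := by
  rw [unitMap, unitMap, over_comp f g _ rfl, pullTri_ε, unitMap]

lemma unitMap_id (A : S) : unitMap (C := C) (𝟙 A) = 𝟙 _ := by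
  have := NatTrans.IsMonoidal.unit (τ := (C.pullId A).inv)
  simp at this
  rw [← vert_id, vert, unitMap, ← this]
  simp

lemma vert_ε {A B : S} (f : A ⟶ B) :
    vert (Functor.LaxMonoidal.ε (C.pull f)) ≫ cart f (𝟙_ (C.fib B)) = unitMap f := by
  rw [vert_comp_cart, unitMap]

lemma vert_μ {A B : S} (f : A ⟶ B) (M N : C.fib B) :
    vert (Functor.LaxMonoidal.μ (C.pull f) M N) ≫ cart f (M ⊗ N) =
      tens (cart f M) (cart f N) (by simp) := by
  rw [vert_comp_cart]
  simp [cart, tens_over]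

lemma tens_assoc {A B : S} {M N P : C.fib A} {M' N' P' : C.fib B} (φ : tot M ⟶ tot M')
    (ψ : tot N ⟶ tot N') (χ : tot P ⟶ tot P') (h : bs ψ = bs φ)
    (h' : bs χ = bs ψ) :
    tens (tens φ ψ h) χ (by rw [tens_base, h', h]) ≫ vert (α_ M' N' P').hom =
      vert (α_ M N P).hom ≫ tens φ (tens ψ χ h') (by rw [tens_base, h]) := by
  obtain ⟨f, φ, ψ, rfl, rfl⟩ := exists_over₂ φ ψ h
  obtain ⟨χ, rfl⟩ := exists_over χ f (h'.trans (over_base _ _))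
  rw [tens_congr _ (tens_over f φ ψ h) rfl,
    tens_congr (by rw [tens_base, h]) rfl (tens_over f ψ χ h')]
  rw [tens_over, tens_over, over_comp_vert, vert_comp_over]
  congr 1
  have h1 : ((φ ⊗ₘ ψ) ≫ Functor.LaxMonoidal.μ (C.pull f) M' N') ⊗ₘ χ =
      ((φ ⊗ₘ ψ) ⊗ₘ χ) ≫ Functor.LaxMonoidal.μ (C.pull f) M' N' ▷ _ := by
    rw [← tensorHom_id, tensorHom_comp_tensorHom, Category.comp_id]
  have h2 : φ ⊗ₘ ((ψ ⊗ₘ χ) ≫ Functor.LaxMonoidal.μ (C.pull f) N' P') =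
      (φ ⊗ₘ (ψ ⊗ₘ χ)) ≫ _ ◁ Functor.LaxMonoidal.μ (C.pull f) N' P' := by
    rw [← id_tensorHom, tensorHom_comp_tensorHom, Category.comp_id]
  rw [h1, h2, Category.assoc, Category.assoc, Category.assoc, Functor.LaxMonoidal.associativity,
    associator_naturality_assoc]

lemma tens_leftUnitor {A B : S} {M : C.fib A} {M' : C.fib B} (φ : tot M ⟶ tot M') (h) :
    tens (unitMap (bs φ)) φ h ≫ vert (λ_ M').hom = vert (λ_ M).hom ≫ φ := by
  obtain ⟨f, φ⟩ := φ
  change tens (unitMap f) (overHom f φ) h ≫ _ = _ ≫ overHom f φ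
  simp only [unitMap, tens_over, over_comp_vert, vert_comp_over]
  congr 1
  rw [← leftUnitor_naturality, Functor.LaxMonoidal.left_unitality]
  simp [tensorHom_def']

lemma tens_rightUnitor {A B : S} {M : C.fib A} {M' : C.fib B} (φ : tot M ⟶ tot M') (h) :
    tens φ (unitMap (bs φ)) h ≫ vert (ρ_ M').hom = vert (ρ_ M).hom ≫ φ := by
  obtain ⟨f, φ⟩ := φ
  change tens (overHom f φ) (unitMap f) h ≫ _ = _ ≫ overHom f φ
  simp only [unitMap, tens_over, over_comp_vert, vert_comp_over]
  congr 1
  rw [← rightUnitor_naturality, Functor.LaxMonoidal.right_unitality]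
  simp [MonoidalCategory.tensorHom_def]

lemma comp_leftUnitor_inv {A B : S} {M : C.fib A} {M' : C.fib B} (φ : tot M ⟶ tot M') :
    φ ≫ vert (λ_ M').inv = vert (λ_ M).inv ≫ tens (unitMap (bs φ)) φ (by simp) := by
  have h := tens_leftUnitor φ (by simp)
  exact (vertIso (λ_ M')).comp_inv_eq.2 (((vertIso (λ_ M)).eq_inv_comp.2 h.symm).trans
    (Category.assoc _ _ _).symm)

lemma comp_rightUnitor_inv {A B : S} {M : C.fib A} {M' : C.fib B} (φ : tot M ⟶ tot M') :
    φ ≫ vert (ρ_ M').inv = vert (ρ_ M).inv ≫ tens φ (unitMap (bs φ)) (by simp) := by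
  have h := tens_rightUnitor φ (by simp)
  exact (vertIso (ρ_ M')).comp_inv_eq.2 (((vertIso (ρ_ M)).eq_inv_comp.2 h.symm).trans
    (Category.assoc _ _ _).symm)

/-! ### Beck-Chevalley and projection maps in the total category. -/

section Push

variable [C.HasPush]

/-- The unit and counit in the mate are absorbed by the cartesian and cocartesian morphisms. By
their universal properties the equation determines the Beck-Chevalley map. -/
lemma vert_beckChevalley {A B D E : S} {f : A ⟶ B} {h : A ⟶ D} {g : B ⟶ E} {k : D ⟶ E}
    (e : f ≫ g = h ≫ k) (M : C.fib D) :
    cocart f _ ≫ vert (C.beckChevalley e M) ≫ cart g _ = cart h M ≫ cocart k M := by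
  simp only [beckChevalley, vert_comp, Category.assoc]
  rw [reassoc_of% (vert_push_map (C := C)), reassoc_of% (vert_push_map (C := C)),
    reassoc_of% (vert_push_map (C := C))]
  erw [reassoc_of% (vert_counit (C := C))]
  rw [vert_pullTri_inv, vert_pullTri]
  erw [reassoc_of% (vert_pull_map (C := C))]
  rw [vert_unit]

lemma vert_projection {A B : S} (f : A ⟶ B) (M : C.fib B) (N : C.fib A) :
    cocart f _ ≫ vert (C.projection f M N) = tens (cart f M) (cocart f N) (by simp) := by
  simp only [projection, vert_comp]
  rw [reassoc_of% (vert_push_map (C := C)), reassoc_of% (vert_push_map (C := C)),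
    vert_counit, vert_μ, ← id_tensorHom, ← tens_vert, tens_comp]
  simp [vert_unit]

lemma vert_projection' {A B : S} (f : A ⟶ B) (N : C.fib A) (M : C.fib B) :
    cocart f _ ≫ vert (C.projection' f N M) = tens (cocart f N) (cart f M) (by simp) := by
  simp only [projection', vert_comp]
  rw [reassoc_of% (vert_push_map (C := C)), reassoc_of% (vert_push_map (C := C)),
    vert_counit, vert_μ, ← tensorHom_id, ← tens_vert, tens_comp]
  simp [vert_unit]

end Push

end Total

/-! ### Morphisms into composite and unit 1-cells. -/

section Pair

variable {S : Type u₁} [Category.{w} S] [CartesianMonoidalCategory S]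
  {C : IndexedSymMonCat.{w, v, u₁, u₂} S}

section Push

variable [C.HasPush]

/-- The cocartesian morphism defining a composite of 1-cells. -/
def compIn {A B D : S} (M : C.fib (A ⊗ B)) (N : C.fib (B ⊗ D)) :
    tot ((C.pull (A ◁ fst B D)).obj M ⊗ (C.pull (snd A (B ⊗ D))).obj N) ⟶ tot (C.comp M N) :=
  cocart (A ◁ snd B D) _

@[simp] lemma compIn_base {A B D : S} (M : C.fib (A ⊗ B)) (N : C.fib (B ⊗ D)) :
    bs (compIn M N) = A ◁ snd B D := (rfl)

lemma compIn_comp_compMap {A B D : S} {M M' : C.fib (A ⊗ B)} {N N' : C.fib (B ⊗ D)}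
    (a : M ⟶ M') (b : N ⟶ N') :
    compIn M N ≫ vert (C.compMap a b) =
      vert ((C.pull (A ◁ fst B D)).map a ⊗ₘ (C.pull (snd A (B ⊗ D))).map b) ≫ compIn M' N' :=
  vert_push_map _ _

/-- The cocartesian morphism defining a unit 1-cell. -/
def unitIn (A : S) : tot (𝟙_ (C.fib A)) ⟶ tot (C.unit A) := cocart (lift (𝟙 A) (𝟙 A)) _

@[simp] lemma unitIn_base (A : S) : bs (unitIn (C := C) A) = lift (𝟙 A) (𝟙 A) := (rfl)

/-- The morphism into a composite of 1-cells given by morphisms into the factors whose underlying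
morphisms agree on the middle object. -/
def pair {X A B D : S} {P Q : C.fib X} {M : C.fib (A ⊗ B)} {N : C.fib (B ⊗ D)}
    (φ : tot P ⟶ tot M) (ψ : tot Q ⟶ tot N)
    (h : bs ψ ≫ fst B D = bs φ ≫ snd A B) :
    tot (P ⊗ Q) ⟶ tot (C.comp M N) :=
  tens (cartLift (A ◁ fst B D) φ (lift (bs φ ≫ fst A B) (bs ψ))
      (by ext <;> simp [h]))
    (cartLift (snd A (B ⊗ D)) ψ (lift (bs φ ≫ fst A B) (bs ψ)) (by simp))
    (by simp) ≫ compIn M N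

@[simp] lemma pair_base {X A B D : S} {P Q : C.fib X} {M : C.fib (A ⊗ B)} {N : C.fib (B ⊗ D)}
    (φ : tot P ⟶ tot M) (ψ : tot Q ⟶ tot N)
    (h : bs ψ ≫ fst B D = bs φ ≫ snd A B) :
    bs (pair φ ψ h) = lift (bs φ ≫ fst A B) (bs ψ ≫ snd B D) := by
  simp [pair]

lemma pair_congr {X A B D : S} {P Q : C.fib X} {M : C.fib (A ⊗ B)} {N : C.fib (B ⊗ D)}
    {φ φ' : tot P ⟶ tot M} {ψ ψ' : tot Q ⟶ tot N}
    (h : bs ψ ≫ fst B D = bs φ ≫ snd A B) (hφ : φ = φ') (hψ : ψ = ψ') :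
    pair φ ψ h = pair φ' ψ' (by rw [← hφ, ← hψ, h]) := by
  subst hφ; subst hψ; rfl

/-- A tensor product followed by a cocartesian morphism is a `pair`. -/
lemma tens_comp_compIn {X A B D : S} {P Q : C.fib X} {M : C.fib (A ⊗ B)} {N : C.fib (B ⊗ D)}
    (φ : tot P ⟶ tot ((C.pull (A ◁ fst B D)).obj M))
    (ψ : tot Q ⟶ tot ((C.pull (snd A (B ⊗ D))).obj N)) (h) :
    tens φ ψ h ≫ compIn M N =
      pair (φ ≫ cart _ M) (ψ ≫ cart _ N) (by simp [h]) := by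
  rw [pair]
  congr 1
  apply tens_congr
  · apply cart_ext
    · rw [cartLift_base]
      ext <;> simp [h]
    · simp
  · apply cart_ext
    · rw [cartLift_base]
      ext <;> simp [h]
    · simp

lemma tens_comp_pair {Y X A B D : S} {P Q : C.fib X} {M : C.fib (A ⊗ B)} {N : C.fib (B ⊗ D)}
    {P' Q' : C.fib Y} (α : tot P' ⟶ tot P) (β : tot Q' ⟶ tot Q) (h')
    (φ : tot P ⟶ tot M) (ψ : tot Q ⟶ tot N)
    (h : bs ψ ≫ fst B D = bs φ ≫ snd A B) :
    tens α β h' ≫ pair φ ψ h = pair (α ≫ φ) (β ≫ ψ) (by simp [h, h']) := by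
  rw [pair, reassoc_of% (tens_comp (C := C)), tens_comp_compIn]
  apply pair_congr <;> simp

lemma pair_comp_compMap {X A B D : S} {P Q : C.fib X} {M M' : C.fib (A ⊗ B)}
    {N N' : C.fib (B ⊗ D)} (φ : tot P ⟶ tot M) (ψ : tot Q ⟶ tot N)
    (h : bs ψ ≫ fst B D = bs φ ≫ snd A B) (a : M ⟶ M') (b : N ⟶ N') :
    pair φ ψ h ≫ vert (C.compMap a b) = pair (φ ≫ vert a) (ψ ≫ vert b) (by simp [h]) := by
  rw [pair, Category.assoc, compIn_comp_compMap, ← tens_vert, reassoc_of% (tens_comp (C := C)),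
    tens_comp_compIn]
  apply pair_congr <;> simp [vert_pull_map, reassoc_of% (cartLift_cart (C := C))]

/-- The morphism from a unit object to a unit 1-cell over the diagonal of `a`. -/
def unitPair {X A : S} (a : X ⟶ A) : tot (𝟙_ (C.fib X)) ⟶ tot (C.unit A) :=
  unitMap a ≫ unitIn A

@[simp] lemma unitPair_base {X A : S} (a : X ⟶ A) :
    bs (unitPair (C := C) a) = lift a a := by
  simp [unitPair]

lemma unitMap_comp_unitPair {Y X A : S} (b : Y ⟶ X) (a : X ⟶ A) :
    unitMap b ≫ unitPair (C := C) a = unitPair (b ≫ a) := by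
  rw [unitPair, unitPair, ← unitMap_comp, Category.assoc]

end Push

/-! ### The bicategory constraints computed on pairs. -/

section

variable [C.HasIndexedHomotopyCoproducts] [C.TensorPreservesCoproducts]

/-- `slideLeft` is built from inverses of the Beck-Chevalley and projection maps. Its own inverse
therefore consists of those maps themselves, whose effect on cocartesian morphisms is known. -/
lemma vert_slideLeft_inv {A B D E F : S} {f : A ⟶ B} {h : A ⟶ D} {g : B ⟶ E} {k : D ⟶ E}
    (e : f ≫ g = h ≫ k) (sq : BCSquare f h g k) (r : B ⟶ F) (r' : A ⟶ F) (er : f ≫ r = r')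
    (Y : C.fib D) (Z : C.fib B) :
    cocart r' _ ≫ vert (C.slideLeft e sq r r' er Y Z).inv =
      tens (cartLift g (cart h Y ≫ cocart k Y) f (by simp [e])) (cart f Z) (by simp) ≫
        cocart r _ := by
  have hp : cocart r' ((C.pull h).obj Y ⊗ (C.pull f).obj Z) ≫
      vert ((C.pushTri f r r' er).inv.app _) = cocart f _ ≫ cocart r _ := by
    rw [← vert_pushTri f r r' er]
    simp only [Category.assoc, ← vert_comp, Iso.hom_inv_id_app]
    erw [vert_id, Category.comp_id]
  have hs : (C.slideLeft e sq r r' er Y Z).inv = (C.pushTri f r r' er).inv.app _ ≫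
      (C.push r).map (C.projection' f _ Z ≫ C.beckChevalley e Y ▷ Z) := by
    simp [slideLeft]
  rw [hs, vert_comp, reassoc_of% hp, vert_push_map, vert_comp, ← tensorHom_id, ← tens_vert]
  simp only [Category.assoc]
  rw [reassoc_of% (vert_projection' (C := C)), reassoc_of% (tens_comp (C := C))]
  congr 1
  apply tens_congr
  · apply cart_ext
    · simp
    · rw [cartLift_cart, Category.assoc, vert_beckChevalley]
  · simp

lemma vert_slideRight_inv {A B D E F : S} {f : A ⟶ B} {h : A ⟶ D} {g : B ⟶ E} {k : D ⟶ E}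
    (e : f ≫ g = h ≫ k) (sq : BCSquare f h g k) (r : B ⟶ F) (r' : A ⟶ F) (er : f ≫ r = r')
    (Z : C.fib B) (Y : C.fib D) :
    cocart r' _ ≫ vert (C.slideRight e sq r r' er Z Y).inv =
      tens (cart f Z) (cartLift g (cart h Y ≫ cocart k Y) f (by simp [e])) (by simp) ≫
        cocart r _ := by
  have hp : cocart r' ((C.pull f).obj Z ⊗ (C.pull h).obj Y) ≫
      vert ((C.pushTri f r r' er).inv.app _) = cocart f _ ≫ cocart r _ := by
    rw [← vert_pushTri f r r' er]
    simp only [Category.assoc, ← vert_comp, Iso.hom_inv_id_app]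
    erw [vert_id, Category.comp_id]
  have hs : (C.slideRight e sq r r' er Z Y).inv = (C.pushTri f r r' er).inv.app _ ≫
      (C.push r).map (C.projection f Z _ ≫ Z ◁ C.beckChevalley e Y) := by
    simp [slideRight]
  rw [hs, vert_comp, reassoc_of% hp, vert_push_map, vert_comp, ← id_tensorHom, ← tens_vert]
  simp only [Category.assoc]
  rw [reassoc_of% (vert_projection (C := C)), reassoc_of% (tens_comp (C := C))]
  congr 1
  apply tens_congr
  · simp
  · apply cart_ext
    · simp
    · rw [cartLift_cart, Category.assoc, vert_beckChevalley]

lemma vert_compCompLeft_inv {A B D E : S} (M : C.fib (A ⊗ B)) (N : C.fib (B ⊗ D))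
    (P : C.fib (D ⊗ E)) :
    cocart _ _ ≫ vert (C.compCompLeft M N P).inv =
      pair (pair (cart _ M) (cart _ N) (by simp)) (cart _ P) (by simp) := by
  -- Here s is the inverse of `slideLeft`; only its effect after the cocartesian morphism matters
  -- below.
  obtain ⟨s, hs, hs'⟩ : ∃ s, (C.compCompLeft M N P).inv = (C.push _).map
      ((((C.pullTri (A ◁ B ◁ fst D E) (A ◁ fst B D) _ (by ext <;> simp)).inv.app M ⊗ₘ
            (C.pullTri (A ◁ B ◁ fst D E) (snd A (B ⊗ D)) _ (by ext <;> simp)).inv.app N) ≫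
          Functor.LaxMonoidal.μ (C.pull (A ◁ B ◁ fst D E)) _ _) ⊗ₘ
        (C.pullTri (A ◁ snd B (D ⊗ E)) (snd A (D ⊗ E)) _ (by ext <;> simp)).inv.app P) ≫ s ∧
      cocart _ _ ≫ vert s = tens (cartLift (A ◁ fst D E) (cart (A ◁ B ◁ fst D E) _ ≫ compIn M N)
        (A ◁ snd B (D ⊗ E)) (by ext <;> simp)) (cart (A ◁ snd B (D ⊗ E)) _) (by simp) ≫
        compIn _ _ :=
    ⟨(C.slideLeft (f := A ◁ snd B (D ⊗ E)) (h := A ◁ B ◁ fst D E) (by ext <;> simp)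
      (square_left A B D E) (A ◁ snd D E) _ (by ext <;> simp) _ _).inv, rfl,
      vert_slideLeft_inv _ _ _ _ _ _ _⟩
  rw [hs, vert_comp, reassoc_of% (vert_push_map (C := C)), hs', ← tens_vert,
    reassoc_of% (tens_comp (C := C)), tens_comp_compIn]
  apply pair_congr
  · rw [Category.assoc, cartLift_cart, vert_comp, Category.assoc,
      reassoc_of% (vert_μ (C := C)), ← tens_vert, reassoc_of% (tens_comp (C := C)),
      tens_comp_compIn]
    apply pair_congr
    · rw [Category.assoc, vert_pullTri_inv]
    · rw [Category.assoc, vert_pullTri_inv]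
  · rw [Category.assoc, vert_pullTri_inv]

lemma vert_compCompRight_inv {A B D E : S} (M : C.fib (A ⊗ B)) (N : C.fib (B ⊗ D))
    (P : C.fib (D ⊗ E)) :
    cocart _ _ ≫ vert (C.compCompRight M N P).inv =
      pair (cart _ M) (pair (cart _ N) (cart _ P) (by simp)) (by simp) := by
  obtain ⟨s, hs, hs'⟩ : ∃ s, (C.compCompRight M N P).inv = (C.push _).map
      ((C.pullTri (A ◁ B ◁ snd D E) (A ◁ fst B E) _ (by ext <;> simp)).inv.app M ⊗ₘ
        (((C.pullTri (snd A (B ⊗ (D ⊗ E))) (B ◁ fst D E) _ rfl).inv.app N ⊗ₘ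
            (C.pullTri (snd A (B ⊗ (D ⊗ E))) (snd B (D ⊗ E)) _ rfl).inv.app P) ≫
          Functor.LaxMonoidal.μ (C.pull (snd A (B ⊗ (D ⊗ E)))) _ _)) ≫ s ∧
      cocart _ _ ≫ vert s = tens (cart (A ◁ B ◁ snd D E) _)
        (cartLift (snd A (B ⊗ E)) (cart (snd A (B ⊗ (D ⊗ E))) _ ≫ compIn N P)
          (A ◁ B ◁ snd D E) (by ext <;> simp)) (by simp) ≫ compIn _ _ :=
    ⟨(C.slideRight (f := A ◁ B ◁ snd D E) (h := snd A (B ⊗ (D ⊗ E))) (by ext <;> simp)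
      (square_right A B D E) (A ◁ snd B E) _ (by ext <;> simp) _ _).inv, rfl,
      vert_slideRight_inv _ _ _ _ _ _ _⟩
  rw [hs, vert_comp, reassoc_of% (vert_push_map (C := C)), hs', ← tens_vert,
    reassoc_of% (tens_comp (C := C)), tens_comp_compIn]
  apply pair_congr
  · rw [Category.assoc, vert_pullTri_inv]
  · rw [Category.assoc, cartLift_cart, vert_comp, Category.assoc,
      reassoc_of% (vert_μ (C := C)), ← tens_vert, reassoc_of% (tens_comp (C := C)),
      tens_comp_compIn]
    apply pair_congr
    · rw [Category.assoc, vert_pullTri_inv]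
    · rw [Category.assoc, vert_pullTri_inv]

/-- The universal case has X = A × B × D × E and cartesian φ, ψ, χ; there both bracketings are
descriptions of the same pushforward. The general case is pulled back from it. -/
lemma pair_pair_assoc {X A B D E : S} {P Q R : C.fib X} {M : C.fib (A ⊗ B)} {N : C.fib (B ⊗ D)}
    {L : C.fib (D ⊗ E)} (φ : tot P ⟶ tot M) (ψ : tot Q ⟶ tot N) (χ : tot R ⟶ tot L)
    (h : bs ψ ≫ fst B D = bs φ ≫ snd A B)
    (h' : bs χ ≫ fst D E = bs ψ ≫ snd B D) :
    pair (pair φ ψ h) χ (by simp [h']) ≫ vert (C.assoc M N L).hom =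
      vert (α_ P Q R).hom ≫ pair φ (pair ψ χ h') (by simp [h]) := by
  -- All three morphisms are lifted over the one map X → A × (B × (D × E)) that they determine, so
  -- that their tensor product makes sense.
  obtain ⟨φ', hφ, hφ'⟩ := exists_cartLift (A ◁ fst B (D ⊗ E)) φ
    (lift (bs φ ≫ fst A B) (lift (bs ψ ≫ fst B D) (bs χ))) (by change _ = bs φ; ext <;> simp [h])
  obtain ⟨ψ', hψ, hψ'⟩ := exists_cartLift (snd A (B ⊗ (D ⊗ E)) ≫ B ◁ fst D E) ψ
    (lift (bs φ ≫ fst A B) (lift (bs ψ ≫ fst B D) (bs χ))) (by change _ = bs ψ; ext <;> simp [h'])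
  obtain ⟨χ', hχ, hχ'⟩ := exists_cartLift (snd A (B ⊗ (D ⊗ E)) ≫ snd B (D ⊗ E)) χ
    (lift (bs φ ≫ fst A B) (lift (bs ψ ≫ fst B D) (bs χ))) (by change _ = bs χ; simp)
  have hb : bs ψ' = bs φ' := hψ.trans hφ.symm
  have hb' : bs χ' = bs ψ' := hχ.trans hψ.symm
  have e : pair (pair φ ψ h) χ (by simp [h']) =
      tens (tens φ' ψ' hb) χ' (by simp [hb, hb']) ≫
        pair (pair (cart _ M) (cart _ N) (by simp)) (cart _ L) (by simp) := by
    rw [tens_comp_pair]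
    refine (pair_congr _ ?_ hχ').symm
    rw [tens_comp_pair]
    exact pair_congr _ hφ' hψ'
  have e' : tens φ' (tens ψ' χ' hb') (by simp [hb]) ≫
        pair (cart _ M) (pair (cart _ N) (cart _ L) (by simp)) (by simp) =
      pair φ (pair ψ χ h') (by simp [h]) := by
    rw [tens_comp_pair]
    refine pair_congr _ hφ' ?_
    rw [tens_comp_pair]
    exact pair_congr _ hψ' hχ'
  have e'' : C.assoc M N L = C.compCompLeft M N L ≪≫ (C.push _).mapIso (α_ _ _ _) ≪≫
    (C.compCompRight M N L).symm := rfl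
  rw [e, ← vert_compCompLeft_inv, ← e', ← vert_compCompRight_inv,
    ← reassoc_of% (tens_assoc (C := C)), e'']
  simp only [Category.assoc, ← vert_comp, Iso.trans_hom, Iso.inv_hom_id_assoc, Functor.mapIso_hom,
    Iso.symm_hom]
  rw [vert_comp, reassoc_of% (vert_push_map (C := C))]

/-- It suffices to treat φ = 𝟙, where the formula unfolds the definition of `leftUnit`; naturality
of the inverse left unitor then gives every φ. -/
lemma comp_vert_leftUnit_inv {X A B : S} {P : C.fib X} {M : C.fib (A ⊗ B)} (φ : tot P ⟶ tot M)
    (a : X ⟶ A) (h : bs φ ≫ fst A B = a) :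
    φ ≫ vert (C.leftUnit M).inv = vert (λ_ P).inv ≫ pair (unitPair a) φ (by simp [h]) := by
  obtain ⟨s, hs, hs'⟩ : ∃ s, (C.leftUnit M).inv = (((λ_ M).inv ≫
      (Functor.LaxMonoidal.ε (C.pull (fst A B)) ⊗ₘ
        ((C.pullOne _ rfl).inv.app M ≫
          (C.pullTri (lift (fst A B) (𝟙 (A ⊗ B))) (snd A (A ⊗ B)) (𝟙 (A ⊗ B))
            (by simp)).inv.app M))) ≫ (C.pushOne _ rfl).inv.app _) ≫ s ∧
      cocart _ _ ≫ vert s = tens (cartLift (A ◁ fst A B) (cart (fst A B) _ ≫ unitIn A)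
        (lift (fst A B) (𝟙 (A ⊗ B))) (by ext <;> simp))
          (cart (lift (fst A B) (𝟙 (A ⊗ B))) _) (by simp) ≫ compIn _ _ :=
    ⟨(C.slideLeft (f := lift (fst A B) (𝟙 (A ⊗ B))) (h := fst A B) (by ext <;> simp)
      (square_unit_left A B) (A ◁ snd A B) (𝟙 (A ⊗ B)) (by ext <;> simp) _ _).inv,
      rfl, vert_slideLeft_inv _ _ _ _ _ _ _⟩
  have e : vert (C.leftUnit M).inv =
      vert (λ_ M).inv ≫ pair (unitPair (fst A B)) (𝟙 (tot M)) (by simp) := by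
    rw [hs, vert_comp, vert_comp, vert_comp, vert_pushOne_inv, ← tens_vert]
    simp only [Category.assoc]
    rw [hs', reassoc_of% (tens_comp (C := C)), tens_comp_compIn]
    congr 1
    apply pair_congr
    · rw [Category.assoc, cartLift_cart, reassoc_of% (vert_ε (C := C)), unitPair]
    · rw [vert_comp]
      simp only [Category.assoc]
      rw [vert_pullTri_inv, vert_pullOne_inv]
  rw [e, reassoc_of% (comp_leftUnitor_inv (C := C)), tens_comp_pair]
  congr 1
  subst h
  exact pair_congr _ (unitMap_comp_unitPair _ _) (Category.comp_id _)

lemma comp_vert_rightUnit_inv {X A B : S} {P : C.fib X} {M : C.fib (A ⊗ B)}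
    (φ : tot P ⟶ tot M) (b : X ⟶ B) (h : bs φ ≫ snd A B = b) :
    φ ≫ vert (C.rightUnit M).inv = vert (ρ_ P).inv ≫ pair φ (unitPair b) (by simp [h]) := by
  obtain ⟨s, hs, hs'⟩ : ∃ s, (C.rightUnit M).inv = (((ρ_ M).inv ≫
      (((C.pullOne _ rfl).inv.app M ≫
          (C.pullTri (A ◁ lift (𝟙 B) (𝟙 B)) (A ◁ fst B B) (𝟙 (A ⊗ B))
            (by ext <;> simp)).inv.app M) ⊗ₘ
        Functor.LaxMonoidal.ε (C.pull (snd A B)))) ≫ (C.pushOne _ rfl).inv.app _) ≫ s ∧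
      cocart _ _ ≫ vert s = tens (cart (A ◁ lift (𝟙 B) (𝟙 B)) _)
        (cartLift (snd A (B ⊗ B)) (cart (snd A B) _ ≫ unitIn B) (A ◁ lift (𝟙 B) (𝟙 B))
          (by ext <;> simp)) (by simp) ≫ compIn _ _ :=
    ⟨(C.slideRight (f := A ◁ lift (𝟙 B) (𝟙 B)) (h := snd A B) (by ext <;> simp)
      (square_unit_right A B) (A ◁ snd B B) (𝟙 (A ⊗ B)) (by ext <;> simp) _ _).inv,
      rfl, vert_slideRight_inv _ _ _ _ _ _ _⟩
  have e : vert (C.rightUnit M).inv =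
      vert (ρ_ M).inv ≫ pair (𝟙 (tot M)) (unitPair (snd A B)) (by simp) := by
    rw [hs, vert_comp, vert_comp, vert_comp, vert_pushOne_inv, ← tens_vert]
    simp only [Category.assoc]
    rw [hs', reassoc_of% (tens_comp (C := C)), tens_comp_compIn]
    congr 1
    apply pair_congr
    · rw [vert_comp]
      simp only [Category.assoc]
      rw [vert_pullTri_inv, vert_pullOne_inv]
    · rw [Category.assoc, cartLift_cart, reassoc_of% (vert_ε (C := C)), unitPair]
  rw [e, reassoc_of% (comp_rightUnitor_inv (C := C)), tens_comp_pair]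
  congr 1
  subst h
  exact pair_congr _ (Category.comp_id _) (unitMap_comp_unitPair _ _)

lemma pair_unit_left {X A B : S} {P : C.fib X} {M : C.fib (A ⊗ B)} (φ : tot P ⟶ tot M)
    (a : X ⟶ A) (h : bs φ ≫ fst A B = a) :
    pair (unitPair a) φ (by simp [h]) ≫ vert (C.leftUnit M).hom = vert (λ_ P).hom ≫ φ := by
  have e := comp_vert_leftUnit_inv φ a h
  exact ((vertIso (λ_ P)).eq_inv_comp.1 (((vertIso (C.leftUnit M)).comp_inv_eq.1 e).trans
    (Category.assoc _ _ _))).symm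

lemma pair_unit_right {X A B : S} {P : C.fib X} {M : C.fib (A ⊗ B)} (φ : tot P ⟶ tot M)
    (b : X ⟶ B) (h : bs φ ≫ snd A B = b) :
    pair φ (unitPair b) (by simp [h]) ≫ vert (C.rightUnit M).hom = vert (ρ_ P).hom ≫ φ := by
  have e := comp_vert_rightUnit_inv φ b h
  exact ((vertIso (ρ_ P)).eq_inv_comp.1 (((vertIso (C.rightUnit M)).comp_inv_eq.1 e).trans
    (Category.assoc _ _ _))).symm

end

end Pair

/-! ### Isomorphisms and factorizations in the total category. -/

section Factorization

variable {S : Type u₁} [Category.{w} S] {C : IndexedSymMonCat.{w, v, u₁, u₂} S}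

/-- The cartesian morphism over an isomorphism, as an isomorphism. -/
def cartIso {A B : S} (f : A ≅ B) (N : C.fib B) : tot ((C.pull f.hom).obj N) ≅ tot N where
  hom := cart f.hom N
  inv := cartLift f.hom (𝟙 (tot N)) f.inv
    ((Iso.inv_hom_id f).trans (id_base N).symm)
  hom_inv_id := by
    apply cart_ext
    · simp
    · simp
  inv_hom_id := by simp

@[simp] lemma cartIso_hom_base {A B : S} (f : A ≅ B) (N : C.fib B) :
    bs (cartIso f N).hom = f.hom := (rfl)

@[simp] lemma cartIso_inv_base {A B : S} (f : A ≅ B) (N : C.fib B) :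
    bs (cartIso f N).inv = f.inv := by
  simp [cartIso]

lemma hom_inv_base {A B : S} {M : C.fib A} {N : C.fib B} (i : tot M ≅ tot N) :
    bs i.hom ≫ bs i.inv = 𝟙 A := by
  rw [← comp_base, Iso.hom_inv_id, id_base]

lemma inv_hom_base {A B : S} {M : C.fib A} {N : C.fib B} (i : tot M ≅ tot N) :
    bs i.inv ≫ bs i.hom = 𝟙 B := by
  rw [← comp_base, Iso.inv_hom_id, id_base]

/-- An isomorphism of the total category over an identity comes from an isomorphism of the fiber. -/
lemma nonempty_iso_of_tot {A : S} {M N : C.fib A} (i : tot M ≅ tot N) (h : bs i.hom = 𝟙 A) :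
    Nonempty (M ≅ N) := by
  have h' : bs i.inv = 𝟙 A := by
    have := hom_inv_base i
    rwa [h, Category.id_comp] at this
  obtain ⟨a, ha⟩ := exists_vert i.hom h
  obtain ⟨b, hb⟩ := exists_vert i.inv h'
  refine ⟨⟨a, b, vert_injective ?_, vert_injective ?_⟩⟩
  · rw [vert_comp, ← ha, ← hb, Iso.hom_inv_id, vert_id]
  · rw [vert_comp, ← ha, ← hb, Iso.inv_hom_id, vert_id]

/-- The identity of M lifts through the cartesian morphism over f⁻¹ and then factors through `cocart
f M`, giving a retraction. The other composite is vertical, so `cocart_ext_vert` identifies it. -/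
lemma isIso_cocart [C.HasPush] {A B : S} (f : A ⟶ B) [IsIso f] (M : C.fib A) :
    IsIso (cocart f M) := by
  obtain ⟨a, ha, ha'⟩ := exists_cartLift (inv f) (𝟙 (tot M)) f (by simp)
  obtain ⟨b, rfl⟩ := exists_cocartDesc f a ha
  have h : cocart f M ≫ vert b ≫ cart (inv f) M = 𝟙 _ := by rw [← ha', Category.assoc]
  refine ⟨vert b ≫ cart (inv f) M, h, ?_⟩
  obtain ⟨c, hc⟩ := exists_vert ((vert b ≫ cart (inv f) M) ≫ cocart f M) (by simp)
  rw [hc, ← vert_id]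
  congr 1
  apply cocart_ext_vert
  rw [← hc, vert_id, Category.comp_id, ← Category.assoc, h, Category.id_comp]

/-- Morphisms over `f` factor through a tensor product of two cartesian morphisms over `f`. -/
lemma exists_comp_tens_cart {A B : S} (f : A ⟶ B) {P : C.fib A} {M N : C.fib B}
    (ψ : tot P ⟶ tot (M ⊗ N)) (h : bs ψ = f) :
    ∃ a, ψ = vert a ≫ tens (cart f M) (cart f N) (by simp) := by
  obtain ⟨b, hb, hb'⟩ := exists_cartLift f ψ (𝟙 A) (by rw [Category.id_comp]; exact h.symm)
  obtain ⟨c, rfl⟩ := exists_vert b hb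
  refine ⟨c ≫ (Functor.Monoidal.μIso (C.pull f) M N).inv, ?_⟩
  rw [← vert_μ, ← reassoc_of% (vert_comp (C := C)), Category.assoc,
    ← Functor.Monoidal.μIso_hom, Iso.inv_hom_id, Category.comp_id, hb']

lemma exists_comp_unitMap {A B : S} (f : A ⟶ B) {P : C.fib A}
    (ψ : tot P ⟶ tot (𝟙_ (C.fib B))) (h : bs ψ = f) :
    ∃ a, ψ = vert a ≫ unitMap f := by
  obtain ⟨b, hb, hb'⟩ := exists_cartLift f ψ (𝟙 A) (by rw [Category.id_comp]; exact h.symm)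
  obtain ⟨c, rfl⟩ := exists_vert b hb
  refine ⟨c ≫ (Functor.Monoidal.εIso (C.pull f)).inv, ?_⟩
  rw [← vert_ε, ← reassoc_of% (vert_comp (C := C)), Category.assoc,
    ← Functor.Monoidal.εIso_hom, Iso.inv_hom_id, Category.comp_id, hb']

/-- A lift φ of an isomorphism through a cartesian morphism behaves like a cartesian one: whatever
factors through `cart t` also factors through φ. -/
lemma exists_cart_eq {A' A B : S} {M : C.fib A'} {K : C.fib B} (i : tot M ≅ tot K) (f : A ⟶ B)
    {t : A' ⟶ A} (φ : tot M ⟶ tot ((C.pull f).obj K)) (ht : bs φ = t)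
    (h : φ ≫ cart f K = i.hom) : ∃ j, cart t _ = vert j ≫ φ := by
  have hb : t ≫ f = bs i.hom := by rw [← h, ← ht]; simp
  obtain ⟨j, hj⟩ := exists_vert (cart t _ ≫ cart f K ≫ i.inv)
    (by simp [reassoc_of% hb, hom_inv_base])
  refine ⟨j, cart_ext (by simp [ht]) ?_⟩
  rw [Category.assoc, h, ← hj]
  simp

lemma tens_id {A : S} (M N : C.fib A) : tens (𝟙 (tot M)) (𝟙 (tot N)) (by simp) = 𝟙 _ := by
  rw [← vert_id (M ⊗ N), ← id_tensorHom_id, ← tens_vert]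
  exact tens_congr _ (vert_id _).symm (vert_id _).symm

lemma eq_id_iff_of_comparison {A B : S} {M : C.fib A} {K : C.fib B} (p : tot M ≅ tot K)
    (T : K ⟶ K) (t : M ⟶ M) (h : p.hom ≫ vert T = vert t ≫ p.hom) : T = 𝟙 K ↔ t = 𝟙 M := by
  constructor
  · rintro rfl
    apply vert_injective
    rw [← cancel_mono p.hom, ← h]
    simp
  · rintro rfl
    apply vert_injective
    rw [← cancel_epi p.hom, h]
    simp

end Factorization

/-! ### Translation of duality data between a fiber and the bicategory. -/

section Duality

variable {S : Type u₁} [Category.{w} S] [CartesianMonoidalCategory S]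
  {C : IndexedSymMonCat.{w, v, u₁, u₂} S}

lemma unitPair_id [C.HasPush] (A : S) : unitPair (C := C) (𝟙 A) = unitIn A := by
  rw [unitPair, unitMap_id, Category.id_comp]

section

variable [C.HasPush] {A : S} {M D : C.fib A} {K : C.fib (A ⊗ 𝟙_ S)} {N : C.fib (𝟙_ S ⊗ A)}
  (p : tot M ≅ tot K) (q : tot D ≅ tot N)
  (hp : bs p.hom = lift (𝟙 A) (toUnit A)) (hq : bs q.hom = lift (toUnit A) (𝟙 A))

include hp hq

lemma exists_coev (η : 𝟙_ (C.fib A) ⟶ M ⊗ D) : ∃ coev : C.unit A ⟶ C.comp K N,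
    unitIn A ≫ vert coev = vert η ≫ pair p.hom q.hom (by simp [hp, hq]) :=
  exists_cocartDesc _ _ (by simp [hp, hq])

/-- Because the middle object is ⋆, the pushforward defining K ⊙ N is along an isomorphism, so
`compIn` can be inverted. What remains is a map over (Δ-like) A → A × (⋆ × A) into a tensor product,
which factors through the reindexed factors M and D. -/
lemma exists_ofCoev (coev : C.unit A ⟶ C.comp K N) : ∃ η : 𝟙_ (C.fib A) ⟶ M ⊗ D,
    unitIn A ≫ vert coev = vert η ≫ pair p.hom q.hom (by simp [hp, hq]) := by
  have : IsIso (A ◁ snd (𝟙_ S) A) := by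
    rw [← leftUnitor_hom]; infer_instance
  have : IsIso (compIn K N) := isIso_cocart _ _
  have hb := congrArg bs (IsIso.inv_hom_id (compIn K N))
  rw [comp_base, compIn_base, id_base] at hb
  -- The two lifts occurring in `pair` are themselves cartesian up to vertical maps j and k, since p
  -- and q are isomorphisms.
  obtain ⟨j, hj⟩ := exists_cart_eq p (A ◁ fst (𝟙_ S) A) (cartLift _ p.hom
    (lift (bs p.hom ≫ fst A (𝟙_ S)) (bs q.hom)) (by ext <;> simp [hp, hq])) (cartLift_base _ _ _ _)
    (cartLift_cart _ _ _ _)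
  obtain ⟨k, hk⟩ := exists_cart_eq q (snd A (𝟙_ S ⊗ A)) (cartLift _ q.hom
    (lift (bs p.hom ≫ fst A (𝟙_ S)) (bs q.hom)) (by simp)) (cartLift_base _ _ _ _)
    (cartLift_cart _ _ _ _)
  obtain ⟨a, ha⟩ := exists_comp_tens_cart (lift (bs p.hom ≫ fst A (𝟙_ S)) (bs q.hom))
    ((unitIn A ≫ vert coev) ≫ inv (compIn K N)) (by
      rw [← cancel_mono (A ◁ snd (𝟙_ S) A), comp_base, Category.assoc, hb]
      ext <;> simp [hp, hq])
  refine ⟨a ≫ (j ⊗ₘ k), ?_⟩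
  rw [tens_congr _ hj hk, ← tens_comp _ _ (by simp) _ _ (by simp), tens_vert] at ha
  rw [pair, vert_comp, Category.assoc, ← reassoc_of% ha, IsIso.inv_hom_id, Category.comp_id]

omit [C.HasPush] hq in
lemma bs_inv_of_eq_lift_left : bs p.inv = fst A (𝟙_ S) := by
  have h := hom_inv_base p
  rw [hp] at h
  have h' : fst A (𝟙_ S) ≫ lift (𝟙 A) (toUnit A) = 𝟙 _ := by ext <;> simp
  rw [← Category.comp_id (fst A (𝟙_ S)), ← h, reassoc_of% h']

omit [C.HasPush] hp in
lemma bs_inv_of_eq_lift_right : bs q.inv = snd (𝟙_ S) A := by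
  have h := hom_inv_base q
  rw [hq] at h
  have h' : snd (𝟙_ S) A ≫ lift (toUnit A) (𝟙 A) = 𝟙 _ := by ext <;> simp
  rw [← Category.comp_id (snd (𝟙_ S) A), ← h, reassoc_of% h']

lemma exists_ev (ε : D ⊗ M ⟶ 𝟙_ (C.fib A)) : ∃ ev : C.comp N K ⟶ C.unit (𝟙_ S),
    pair q.hom p.hom (by simp [hp, hq]) ≫ vert ev = vert ε ≫ unitPair (toUnit A) := by
  have hp' := bs_inv_of_eq_lift_left p hp
  have hq' := bs_inv_of_eq_lift_right q hq
  -- On ⋆ × (A × ⋆) the reindexed N and K map back to D and M through q⁻¹ and p⁻¹, both over the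
  -- projection to A. The composite with ε descends along the pushforward.
  obtain ⟨ev, hev⟩ := exists_cocartDesc (𝟙_ S ◁ snd A (𝟙_ S))
    (tens (cart (𝟙_ S ◁ fst A (𝟙_ S)) N ≫ q.inv) (cart (snd (𝟙_ S) (A ⊗ 𝟙_ S)) K ≫ p.inv)
      (by simp [hp', hq', leftUnitor_hom]) ≫ vert ε ≫ unitPair (toUnit A))
    (by ext)
  change compIn N K ≫ vert (N := C.unit (𝟙_ S)) ev = _ at hev
  refine ⟨ev, ?_⟩
  rw [pair, Category.assoc, hev, reassoc_of% (tens_comp (C := C))]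
  conv_rhs => rw [← Category.id_comp (vert ε ≫ _), ← tens_id]
  congr 1
  apply tens_congr
  · rw [reassoc_of% (cartLift_cart (C := C)), Iso.hom_inv_id]
  · rw [reassoc_of% (cartLift_cart (C := C)), Iso.hom_inv_id]

/-- The diagonal of ⋆ is invertible, so U_⋆ may be replaced by I_⋆; a map to I_⋆ over A → ⋆ is a map
to I_A, as reindexing preserves units. -/
lemma exists_ofEv (ev : C.comp N K ⟶ C.unit (𝟙_ S)) : ∃ ε : D ⊗ M ⟶ 𝟙_ (C.fib A),
    pair q.hom p.hom (by simp [hp, hq]) ≫ vert ev = vert ε ≫ unitPair (toUnit A) := by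
  have : IsIso (lift (𝟙 (𝟙_ S)) (𝟙 (𝟙_ S))) :=
    ⟨fst _ _, by simp, by ext⟩
  have : IsIso (unitIn (C := C) (𝟙_ S)) := isIso_cocart _ _
  obtain ⟨a, ha⟩ := exists_comp_unitMap (toUnit A)
    ((pair q.hom p.hom (by simp [hp, hq]) ≫ vert ev) ≫ inv (unitIn (𝟙_ S)))
    (toUnit_unique _ _)
  refine ⟨a, ?_⟩
  rw [unitPair, ← Category.assoc, ← ha, Category.assoc, IsIso.inv_hom_id, Category.comp_id]

end

/-! ### Comparison of the triangle composites. -/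

section

variable [C.HasIndexedHomotopyCoproducts] [C.TensorPreservesCoproducts]
  {A : S} {M D : C.fib A} {K : C.fib (A ⊗ 𝟙_ S)} {N : C.fib (𝟙_ S ⊗ A)}
  (p : tot M ⟶ tot K) (q : tot D ⟶ tot N)
  (hp : bs p = lift (𝟙 A) (toUnit A)) (hq : bs q = lift (toUnit A) (𝟙 A))
  (η : 𝟙_ (C.fib A) ⟶ M ⊗ D) (ε : D ⊗ M ⟶ 𝟙_ (C.fib A))
  (coev : C.unit A ⟶ C.comp K N) (ev : C.comp N K ⟶ C.unit (𝟙_ S))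
  (h₁ : unitIn A ≫ vert coev = vert η ≫ pair p q (by simp [hp, hq]))
  (h₂ : pair q p (by simp [hp, hq]) ≫ vert ev = vert ε ≫ unitPair (toUnit A))

include h₁ h₂

/-- The isomorphism p is carried through the composite one constraint at a time: each 2-cell of the
bicategory, applied to a pair, becomes the corresponding map of the fiber. -/
lemma triangle_left_comparison :
    p ≫ vert ((C.leftUnit K).inv ≫ C.compMap coev (𝟙 K) ≫ (C.assoc K N K).hom ≫
        C.compMap (𝟙 K) ev ≫ (C.rightUnit K).hom) =
      vert ((λ_ M).inv ≫ η ▷ M ≫ (α_ M D M).hom ≫ M ◁ ε ≫ (ρ_ M).hom) ≫ p := by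
  have e₁ : tens (vert η) (vert (𝟙 M)) (by simp) ≫
      pair (pair p q (by simp [hp, hq])) p (by simp [hp, hq]) =
      pair (unitPair (𝟙 A)) p (by simp [hp]) ≫ vert (C.compMap coev (𝟙 K)) := by
    rw [tens_comp_pair, pair_comp_compMap]
    exact pair_congr _ (by rw [← h₁, unitPair_id]) (by simp)
  have e₂ : tens (vert (𝟙 M)) (vert ε) (by simp) ≫ pair p (unitPair (toUnit A)) (by simp [hp]) =
      pair p (pair q p (by simp [hp, hq])) (by simp [hp, hq]) ≫ vert (C.compMap (𝟙 K) ev) := by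
    rw [tens_comp_pair, pair_comp_compMap]
    exact pair_congr _ (by simp) h₂.symm
  rw [← id_tensorHom, ← tensorHom_id]
  simp only [vert_comp, Category.assoc, ← tens_vert]
  rw [← pair_unit_right p (toUnit A) (by simp [hp]), reassoc_of% e₂,
    ← reassoc_of% (pair_pair_assoc p q p (by simp [hp, hq]) (by simp [hp, hq])), reassoc_of% e₁,
    reassoc_of% (comp_vert_leftUnit_inv p (𝟙 A) (by simp [hp]))]

lemma triangle_right_comparison :
    q ≫ vert ((C.rightUnit N).inv ≫ C.compMap (𝟙 N) coev ≫ (C.assoc N K N).inv ≫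
        C.compMap ev (𝟙 N) ≫ (C.leftUnit N).hom) =
      vert ((ρ_ D).inv ≫ D ◁ η ≫ (α_ D M D).inv ≫ ε ▷ D ≫ (λ_ D).hom) ≫ q := by
  have e₁ : tens (vert (𝟙 D)) (vert η) (by simp) ≫
      pair q (pair p q (by simp [hp, hq])) (by simp [hp, hq]) =
      pair q (unitPair (𝟙 A)) (by simp [hq]) ≫ vert (C.compMap (𝟙 N) coev) := by
    rw [tens_comp_pair, pair_comp_compMap]
    exact pair_congr _ (by simp) (by rw [← h₁, unitPair_id])
  have e₂ : tens (vert ε) (vert (𝟙 D)) (by simp) ≫ pair (unitPair (toUnit A)) q (by simp [hq]) =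
      pair (pair q p (by simp [hp, hq])) q (by simp [hp, hq]) ≫ vert (C.compMap ev (𝟙 N)) := by
    rw [tens_comp_pair, pair_comp_compMap]
    exact pair_congr _ h₂.symm (by simp)
  -- This triangle uses the inverse associator, so `pair_pair_assoc` is turned around.
  have e₃ := (vertIso (α_ D M D)).inv_comp_eq.2 (((vertIso (C.assoc N K N)).eq_comp_inv.2
    (pair_pair_assoc q p q (by simp [hp, hq]) (by simp [hp, hq]))).trans (Category.assoc _ _ _))
  rw [vertIso_inv, vertIso_inv] at e₃
  rw [← id_tensorHom, ← tensorHom_id]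
  simp only [vert_comp, Category.assoc, ← tens_vert]
  rw [← pair_unit_left q (toUnit A) (by simp [hq]), reassoc_of% e₂, reassoc_of% e₃,
    reassoc_of% e₁, reassoc_of% (comp_vert_rightUnit_inv q (𝟙 A) (by simp [hq]))]

end

/-! ### Equivalence of the two notions of duality. -/

section

variable [C.HasIndexedHomotopyCoproducts] [C.TensorPreservesCoproducts]
  {A : S} {M D : C.fib A} {K : C.fib (A ⊗ 𝟙_ S)} {N : C.fib (𝟙_ S ⊗ A)}
  (p : tot M ≅ tot K) (q : tot D ≅ tot N)
  (hp : bs p.hom = lift (𝟙 A) (toUnit A)) (hq : bs q.hom = lift (toUnit A) (𝟙 A))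

include hp hq

lemma nonempty_rightDual (e : ExactPairing M D) : Nonempty (C.RightDual K N) := by
  obtain ⟨coev, h₁⟩ := exists_coev p q hp hq (η_ M D)
  obtain ⟨ev, h₂⟩ := exists_ev p q hp hq (ε_ M D)
  refine ⟨⟨coev, ev, ?_, ?_⟩⟩
  · rw [eq_id_iff_of_comparison p _ _ (triangle_left_comparison p.hom q.hom hp hq _ _ _ _ h₁ h₂),
      reassoc_of% (ExactPairing.evaluation_coevaluation (X := M) (Y := D))]
    simp
  · rw [eq_id_iff_of_comparison q _ _ (triangle_right_comparison p.hom q.hom hp hq _ _ _ _ h₁ h₂),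
      reassoc_of% (ExactPairing.coevaluation_evaluation (X := M) (Y := D))]
    simp

lemma nonempty_exactPairing (d : C.RightDual K N) : Nonempty (ExactPairing M D) := by
  obtain ⟨η, h₁⟩ := exists_ofCoev p q hp hq d.coev
  obtain ⟨ε, h₂⟩ := exists_ofEv p q hp hq d.ev
  have hl := (eq_id_iff_of_comparison p _ _
    (triangle_left_comparison p.hom q.hom hp hq _ _ _ _ h₁ h₂)).1 d.triangle_left
  have hr := (eq_id_iff_of_comparison q _ _
    (triangle_right_comparison p.hom q.hom hp hq _ _ _ _ h₁ h₂)).1 d.triangle_right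
  refine ⟨⟨η, ε, ?_, ?_⟩⟩
  · rw [← cancel_epi (ρ_ D).inv, ← cancel_mono (λ_ D).hom]
    simpa using hr
  · rw [← cancel_epi (λ_ M).inv, ← cancel_mono (ρ_ M).hom]
    simpa using hl

end

/-- The isomorphism from `M` to `hat M` in the total category. -/
def hatIso {A : S} (M : C.fib A) : tot M ≅ tot (C.hat M) := (cartIso (ρ_ A) M).symm

lemma hatIso_base {A : S} (M : C.fib A) : bs (hatIso M).hom = lift (𝟙 A) (toUnit A) := by
  refine (cartIso_inv_base (ρ_ A) M).trans ?_
  ext <;> simp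

/-- The isomorphism from `M` to `check M` in the total category. -/
def checkIso {A : S} (M : C.fib A) : tot M ≅ tot (C.check M) := (cartIso (λ_ A) M).symm

lemma checkIso_base {A : S} (M : C.fib A) : bs (checkIso M).hom = lift (toUnit A) (𝟙 A) := by
  refine (cartIso_inv_base (λ_ A) M).trans ?_
  ext <;> simp

/-- Supplies the object D of the fiber to which a given right dual N corresponds. -/
lemma exists_iso_of_unit_tensor {A : S} (N : C.fib (𝟙_ S ⊗ A)) :
    ∃ (D : C.fib A) (q : tot D ≅ tot N), bs q.hom = lift (toUnit A) (𝟙 A) := by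
  refine ⟨_, cartIso (λ_ A).symm N, (cartIso_hom_base _ _).trans ?_⟩
  ext <;> simp

end Duality

end IndexedSymMonCat

end

theorem mainTheorem2 {S : Type u₁} [Category.{w} S] [CartesianMonoidalCategory S]
    (C : IndexedSymMonCat.{w, v, u₁, u₂} S) [C.HasIndexedHomotopyCoproducts]
    [C.TensorPreservesCoproducts] {A : S} (M : C.fib A) :
    (C.IsDualizable M ↔ C.IsRightDualizable (C.hat M)) ∧
      ∀ D : C.fib A, Nonempty (ExactPairing M D) →
        Nonempty (C.RightDual (C.hat M) (C.check D)) ∧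
          ∀ N : C.fib (𝟙_ S ⊗ A), Nonempty (C.RightDual (C.hat M) N) →
            Nonempty (N ≅ C.check D) := by
  open IndexedSymMonCat in
  have h : ∀ D : C.fib A, Nonempty (ExactPairing M D) →
      Nonempty (C.RightDual (C.hat M) (C.check D)) := fun D ⟨e⟩ ↦
    nonempty_rightDual (hatIso M) (checkIso D) (hatIso_base M) (checkIso_base D) e
  refine ⟨⟨fun ⟨D, hD⟩ ↦ ⟨C.check D, h D hD⟩, fun ⟨N, ⟨d⟩⟩ ↦ ?_⟩,
    fun D hD ↦ ⟨h D hD, fun N ⟨d⟩ ↦ ?_⟩⟩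
  · obtain ⟨D, q, hq⟩ := exists_iso_of_unit_tensor N
    exact ⟨D, nonempty_exactPairing (hatIso M) q (hatIso_base M) hq d⟩
  · obtain ⟨D', q, hq⟩ := exists_iso_of_unit_tensor N
    obtain ⟨e'⟩ := nonempty_exactPairing (hatIso M) q (hatIso_base M) hq d
    obtain ⟨e⟩ := hD
    -- D' and D are both duals of M in the fiber, hence isomorphic. The outer two maps lie over
    -- mutually inverse base maps, so the composite is vertical.
    refine nonempty_iso_of_tot (q.symm ≪≫ vertIso (rightDualIso e' e) ≪≫ checkIso D) ?_
    change bs (q.inv ≫ vert (rightDualIso e' e).hom ≫ (checkIso D).hom) = _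
    rw [comp_base, comp_base, vert_base, Category.id_comp, checkIso_base, ← hq, inv_hom_base]
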